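/- For a finite nonempty set $\mathcal D\subset\mathbb Z$ let $\delta_{\mathcal D}=\frac1{\#\mathcal D}\sum_{d\in\mathcal D}\delta_d$. For an integer $N\ge 2$ let $\mu_{N,\mathcal D}$ be the equal-weight self-similar measure, i.e. the unique Borel probability measure $\mu$ on $\mathbb R$ with $\mu(E)=\sum_{d\in\mathcal D}\frac1{\#\mathcal D}\,\mu(\phi_d^{-1}(E))$ for all Borel $E$, where $\phi_d(x)=\frac1N(x+d)$; equivalently $\mu_{N,\mathcal D}=\delta_{\mathcal D/N}*\delta_{\mathcal D/N^2}*\cdots$. A Borel probability measure $\mu$ on $\mathbb R$ is *spectral* if there is a countable $\Lambda\subset\mathbb R$ such that $\{e^{2\pi i\lambda x}:\lambda\in\Lambda\}$ is an orthonormal basis of $L^2(\mu)$. For finite sets $\mathcal D,\mathcal L\subset\mathbb Z$ with $\mathcal D\neq\emptyset$, $(N,\mathcal D,\mathcal L)$ is a *Hadamard triple* if the matrix $\frac1{\sqrt{\#\mathcal D}}\big(e^{2\pi i d\ell/N}\big)_{d\in\mathcal D,\ell\in\mathcal L}$ is unitary. We write $X\oplus Y$ for $X+Y=\{x+y: x\in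 X,\,y\in Y\}$ when all these sums are distinct. Let $N\ge 2$ be an integer and let $\mathcal D,\mathcal L_1,\mathcal L_2\subset\mathbb Z$ be finite sets such that the sum $\mathcal L_1\oplus\mathcal L_2$ is direct. Suppose that $(N,\mathcal D,\mathcal L_1\oplus\mathcal L_2)$ is a one-stage product-form Hadamard triple, that is, there are an integer $r\ge 0$, a set $\mathcal A=\{a_0,\dots,a_{n-1}\}$ of $n$ distinct integers and finite sets $\mathcal B_0,\dots,\mathcal B_{n-1}\subset\mathbb Z$ such that $$\mathcal D=\bigcup_{s=0}^{n-1}\left(a_s+N^r\mathcal B_s\right),$$ $(N,\mathcal A,\mathcal L_1)$ is a Hadamard triple, and for every $s=0,\dots,n-1$ 1. $(N,\mathcal B_s,\mathcal L_2)$ is a Hadamard triple; 2. the sum $\mathcal A\oplus\mathcal B_s$ is direct and $(N,\mathcal A\oplus\mathcal B_s,\mathcal L_1\oplus\mathcal L_2)$ is a Hadamard triple; where in the degenerate case $r=0$ it is also required that $(N,\mathcal D,\mathcal L_1\oplus\mathcal L_2)$ itself is a Hadamard triple (nothing further is required when $r\ge 1$). Then the self-similar measure $\mu_{N,\mathcal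 D}$ is a spectral measure. -/

import Mathlib

open MeasureTheory
open scoped Pointwise

noncomputable section

/-! ### Spectral measures -/

/-- `μ` is a Borel probability measure on `ℝ` and there is a countable set `Λ` of reals such that
the exponentials `x ↦ e^{2πiλx}`, `λ ∈ Λ`, form an orthonormal (Hilbert) basis of `L²(μ)`. -/
def IsSpectralMeasure (μ : Measure ℝ) : Prop :=
  IsProbabilityMeasure μ ∧
    ∃ Λ : Set ℝ, Λ.Countable ∧
      ∃ b : HilbertBasis Λ ℂ (Lp ℂ 2 μ),
        ∀ l : Λ, (b l : ℝ → ℂ) =ᵐ[μ]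
          fun x : ℝ => Complex.exp (2 * Real.pi * Complex.I * (l : ℝ) * x)

/-! ### Hadamard triples -/

/-- The matrix `(#D)^{-1/2} (e^{2πi dℓ/N})`, with rows `d ∈ D` and columns `ℓ ∈ L`. -/
def hadamardMatrix (N : ℕ) (D L : Finset ℤ) : Matrix D L ℂ :=
  fun d l => (1 / (Real.sqrt (D.card : ℝ) : ℂ)) *
    Complex.exp (2 * Real.pi * Complex.I * (((d : ℤ) : ℂ) * ((l : ℤ) : ℂ) / (N : ℂ)))

/-- `(N, D, L)` is an (integral) Hadamard triple: `D` is nonempty and the matrix above is unitary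
(the two identities together force `#D = #L`). -/
structure IsHadamardTriple (N : ℕ) (D L : Finset ℤ) : Prop where
  nonempty : D.Nonempty
  mul_conjTranspose : hadamardMatrix N D L * (hadamardMatrix N D L).conjTranspose = 1
  conjTranspose_mul : (hadamardMatrix N D L).conjTranspose * hadamardMatrix N D L = 1

/-- The sum `A + B` is direct, i.e. all sums `a + b` are distinct; then `A + B` is `A ⊕ B`. -/
def IsDirectSum (A B : Finset ℤ) : Prop :=
  (A + B).card = A.card * B.card

/-! ### One-stage product-form Hadamard triples -/

/-- The digit set `⋃_{a ∈ A} (a + N^r B_a)`. -/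
def productFormDigits (N r : ℕ) (A : Finset ℤ) (B : ℤ → Finset ℤ) : Finset ℤ :=
  A.biUnion fun a => (B a).image fun b => a + (N : ℤ) ^ r * b

/-- `(N, D, L₁ ⊕ L₂)` is a one-stage product-form Hadamard triple. The finite set `A` is
`{a_s : 0 ≤ s < n}` and the set `B_s` is written `B a` for `a = a_s`.
In the degenerate case `r = 0`, where nothing is placed at a higher scale, the notion is that
of an ordinary Hadamard triple, which is the content of the last condition; it is void for
`r ≥ 1`. -/
def IsProductFormHadamardTriple (N : ℕ) (D L₁ L₂ : Finset ℤ) : Prop :=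
  2 ≤ N ∧ IsDirectSum L₁ L₂ ∧
    ∃ (A : Finset ℤ) (B : ℤ → Finset ℤ) (r : ℕ),
      D = productFormDigits N r A B ∧
      IsHadamardTriple N A L₁ ∧
      (∀ a ∈ A, IsHadamardTriple N (B a) L₂) ∧
      (∀ a ∈ A, IsDirectSum A (B a) ∧ IsHadamardTriple N (A + B a) (L₁ + L₂)) ∧
      (r = 0 → IsHadamardTriple N D (L₁ + L₂))

/-! ### Self-similar measures -/

/-- `μ` is an equal-weight self-similar measure of the maps `φ_d(x) = (x + d)/N`, `d ∈ D`: a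
Borel probability measure with `μ(E) = ∑_{d ∈ D} (1/#D) μ(φ_d⁻¹(E))` for all Borel sets `E`. -/
structure IsSelfSimilarMeasure (N : ℕ) (D : Finset ℤ) (μ : Measure ℝ) : Prop where
  isProbabilityMeasure : IsProbabilityMeasure μ
  invariant : ∀ E : Set ℝ, MeasurableSet E →
    μ E = ∑ d ∈ D, (D.card : ENNReal)⁻¹ * μ ((fun x : ℝ => (x + (d : ℝ)) / (N : ℝ)) ⁻¹' E)

/-- The sum `∑_{j ≥ 1} d_j N^{-j}` (with the digits indexed from `0`). -/
def digitSum (N : ℕ) (D : Finset ℤ) (ω : ℕ → D) : ℝ :=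
  ∑' j : ℕ, ((ω j : ℤ) : ℝ) / (N : ℝ) ^ (j + 1)

/-- The self-similar measure `μ_{N,D}`: the law of `∑_{j ≥ 1} d_j N^{-j}` with independent digits
`d_j` uniformly distributed on `D`, that is, the infinite convolution
`δ_{D/N} * δ_{D/N²} * ⋯`. It is the unique self-similar measure in the sense of
`IsSelfSimilarMeasure`, see `isSelfSimilarMeasure_iff`. -/
def selfSimilarMeasure (N : ℕ) (D : Finset ℤ) : Measure ℝ :=
  (Measure.infinitePi fun _ : ℕ => ProbabilityTheory.uniformOn (Set.univ : Set D)).map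
    (digitSum N D)

/-! ### Existence and uniqueness of the self-similar measure -/

theorem digitSum_bound (D : Finset ℤ) : ∃ C : ℝ, ∀ d : D, |((d : ℤ) : ℝ)| ≤ C := by
  refine ⟨∑ d ∈ D, |(d : ℝ)|, fun d => ?_⟩
  exact Finset.single_le_sum (f := fun d : ℤ => |(d : ℝ)|) (fun _ _ => abs_nonneg _) d.2

theorem summable_bound {N : ℕ} (hN : 2 ≤ N) (C : ℝ) :
    Summable fun j : ℕ => C / (N : ℝ) ^ (j + 1) := by
  have h : Summable fun j : ℕ => ((N : ℝ)⁻¹) ^ j :=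
    summable_geometric_of_lt_one (by positivity)
      (inv_lt_one_of_one_lt₀ (by exact_mod_cast (by omega : 1 < N)))
  refine ((summable_nat_add_iff 1).2 h).mul_left C |>.congr fun j => ?_
  rw [inv_pow, div_eq_mul_inv]

theorem norm_digit_le {N : ℕ} {D : Finset ℤ} {C : ℝ} (hC : ∀ d : D, |((d : ℤ) : ℝ)| ≤ C)
    (j : ℕ) (ω : ℕ → D) : ‖((ω j : ℤ) : ℝ) / (N : ℝ) ^ (j + 1)‖ ≤ C / (N : ℝ) ^ (j + 1) := by
  rw [norm_div, Real.norm_eq_abs, norm_pow, Real.norm_natCast]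
  exact div_le_div_of_nonneg_right (hC _) (by positivity)

theorem measurable_digitSum {N : ℕ} (hN : 2 ≤ N) (D : Finset ℤ) :
    Measurable (digitSum N D) := by
  obtain ⟨C, hC⟩ := digitSum_bound D
  refine Continuous.measurable (continuous_tsum (fun j => ?_) (summable_bound hN C)
    (norm_digit_le hC))
  exact ((continuous_of_discreteTopology (f := fun d : D => ((d : ℤ) : ℝ))).comp
    (continuous_apply j)).div_const _

/-- Prepend a digit to a sequence of digits. -/
def consDigit {α : Type*} (p : α × (ℕ → α)) : ℕ → α :=
  fun j => Nat.casesOn j p.1 p.2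

theorem measurable_consDigit {α : Type*} [MeasurableSpace α] :
    Measurable (consDigit : α × (ℕ → α) → ℕ → α) := by
  refine measurable_pi_lambda _ fun j => ?_
  cases j with
  | zero => exact measurable_fst
  | succ k => exact (measurable_pi_apply k).comp measurable_snd

theorem digitSum_consDigit {N : ℕ} (hN : 2 ≤ N) (D : Finset ℤ) (d : D) (ω : ℕ → D) :
    digitSum N D (consDigit (d, ω)) = (digitSum N D ω + ((d : ℤ) : ℝ)) / N := by
  obtain ⟨C, hC⟩ := digitSum_bound D
  have hs : ∀ ω : ℕ → D, Summable fun j : ℕ => ((ω j : ℤ) : ℝ) / (N : ℝ) ^ (j + 1) := fun ω =>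
    Summable.of_norm_bounded (summable_bound hN C) fun j => norm_digit_le hC j ω
  unfold digitSum
  rw [(hs _).tsum_eq_zero_add, add_div, ← tsum_div_const, add_comm]
  congr 1
  · refine tsum_congr fun j => ?_
    simp only [consDigit]
    rw [div_div, ← pow_succ]
  · simp [consDigit]

theorem map_consDigit {α : Type*} [MeasurableSpace α] (μ : Measure α) [IsProbabilityMeasure μ] :
    (μ.prod (Measure.infinitePi fun _ : ℕ => μ)).map consDigit =
      Measure.infinitePi fun _ : ℕ => μ := by
  classical
  have key : ∀ (n : ℕ) (t : ℕ → Set α), (∀ i, MeasurableSet (t i)) →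
      (μ.prod (Measure.infinitePi fun _ : ℕ => μ)).map consDigit
        (Set.pi (Finset.range (n + 1) : Finset ℕ) t) = ∏ i ∈ Finset.range (n + 1), μ (t i) := by
    intro n t ht
    have hpre : consDigit ⁻¹' (Set.pi (Finset.range (n + 1) : Finset ℕ) t) =
        t 0 ×ˢ Set.pi (Finset.range n : Finset ℕ) (fun k => t (k + 1)) := by
      ext ⟨x, ω⟩
      simp only [Set.mem_preimage, Set.mem_pi, Finset.coe_range, Set.mem_Iio, Set.mem_prod]
      constructor
      · intro h
        exact ⟨h 0 (by omega), fun k hk => h (k + 1) (by omega)⟩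
      · rintro ⟨h0, h1⟩ i hi
        cases i with
        | zero => exact h0
        | succ k => exact h1 k (by omega)
    rw [Measure.map_apply measurable_consDigit
      (MeasurableSet.pi (Finset.countable_toSet _) fun i _ => ht i), hpre, Measure.prod_prod,
      Measure.infinitePi_pi _ (fun i _ => ht (i + 1)), Finset.prod_range_succ', mul_comm]
  refine Measure.eq_infinitePi _ fun s t ht => ?_
  obtain ⟨n, hn⟩ : ∃ n, s ⊆ Finset.range (n + 1) :=
    ⟨s.sup id, fun i hi => Finset.mem_range.2 (Nat.lt_succ_of_le (Finset.le_sup (f := id) hi))⟩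
  have h1 : Set.pi (s : Set ℕ) t =
      Set.pi (Finset.range (n + 1) : Finset ℕ) (fun i => if i ∈ s then t i else Set.univ) := by
    ext ω
    simp only [Set.mem_pi, Finset.mem_coe]
    constructor
    · intro h i _
      by_cases hi : i ∈ s
      · simpa [hi] using h i hi
      · simp [hi]
    · intro h i hi
      simpa [hi] using h i (hn hi)
  rw [h1, key]
  · rw [← Finset.prod_subset hn]
    · exact Finset.prod_congr rfl fun i hi => by simp [hi]
    · intro i _ hi
      simp [hi]
  · intro i
    by_cases hi : i ∈ s
    · simpa [hi] using ht i
    · simp [hi]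

theorem isSelfSimilarMeasure_selfSimilarMeasure {N : ℕ} (hN : 2 ≤ N) {D : Finset ℤ}
    (hD : D.Nonempty) : IsSelfSimilarMeasure N D (selfSimilarMeasure N D) := by
  have : Nonempty D := hD.to_subtype
  have : IsProbabilityMeasure (ProbabilityTheory.uniformOn (Set.univ : Set D)) :=
    ProbabilityTheory.isProbabilityMeasure_uniformOn Set.finite_univ Set.univ_nonempty
  have hX := measurable_digitSum hN D
  refine ⟨Measure.isProbabilityMeasure_map hX.aemeasurable, fun E hE => ?_⟩
  have hφ : ∀ d : ℤ, Measurable fun x : ℝ => (x + (d : ℝ)) / (N : ℝ) := fun d => by fun_prop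
  unfold selfSimilarMeasure
  conv_lhs => rw [← map_consDigit, Measure.map_map hX measurable_consDigit]
  rw [Measure.map_apply (hX.comp measurable_consDigit) hE,
    Measure.prod_apply ((hX.comp measurable_consDigit) hE), lintegral_fintype,
    ← Finset.sum_coe_sort D]
  refine Finset.sum_congr rfl fun d _ => ?_
  rw [Measure.map_apply hX (hφ d hE), mul_comm]
  congr 1
  · classical
    rw [ProbabilityTheory.uniformOn_univ]
    simp
  · congr 1
    ext ω
    simp [digitSum_consDigit hN]

theorem IsSelfSimilarMeasure.charFun_eq {N : ℕ} {D : Finset ℤ} {μ : Measure ℝ}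
    (h : IsSelfSimilarMeasure N D μ) (t : ℝ) :
    charFun μ t = (∑ d ∈ D, (D.card : ℂ)⁻¹ * Complex.exp (t * (d / N) * Complex.I)) *
      charFun μ (t / N) := by
  have := h.isProbabilityMeasure
  have hφ : ∀ d : ℤ, Measurable fun x : ℝ => (x + (d : ℝ)) / (N : ℝ) := fun d => by fun_prop
  have hμ : μ = ∑ d ∈ D, (D.card : ENNReal)⁻¹ •
      μ.map (fun x : ℝ => (x + (d : ℝ)) / (N : ℝ)) := by
    ext E hE
    rw [h.invariant E hE, Measure.finsetSum_apply]
    refine Finset.sum_congr rfl fun d _ => ?_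
    rw [Measure.smul_apply, Measure.map_apply (hφ d) hE, smul_eq_mul]
  have hD : D.Nonempty := by
    by_contra hD
    rw [Finset.not_nonempty_iff_eq_empty] at hD
    exact IsProbabilityMeasure.ne_zero μ (by rw [hμ, hD, Finset.sum_empty])
  have hc : (D.card : ENNReal)⁻¹ ≠ ⊤ := by
    simpa using hD.ne_empty
  have hprob : ∀ d : ℤ, IsProbabilityMeasure (μ.map fun x : ℝ => (x + (d : ℝ)) / (N : ℝ)) :=
    fun d => Measure.isProbabilityMeasure_map (hφ d).aemeasurable
  have hint : ∀ (ν : Measure ℝ) [IsFiniteMeasure ν],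
      Integrable (fun x : ℝ => Complex.exp (t * x * Complex.I)) ν := by
    intro ν _
    refine Integrable.of_bound (C := 1) (by fun_prop) (Filter.Eventually.of_forall fun x => ?_)
    rw [← Complex.ofReal_mul, Complex.norm_exp_ofReal_mul_I]
  have hstep : charFun μ t = ∑ d ∈ D, (D.card : ℂ)⁻¹ *
      charFun (μ.map fun x : ℝ => (x + (d : ℝ)) / (N : ℝ)) t := by
    conv_lhs => rw [hμ]
    simp only [charFun_apply_real]
    rw [integral_finsetSum_measure fun d _ => (hint _).smul_measure hc]
    refine Finset.sum_congr rfl fun d _ => ?_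
    rw [integral_smul_measure]
    simp
  rw [hstep, Finset.sum_mul]
  refine Finset.sum_congr rfl fun d _ => ?_
  rw [mul_assoc]
  congr 1
  rw [charFun_apply_real, charFun_apply_real, integral_map (hφ d).aemeasurable (by fun_prop),
    ← integral_const_mul]
  refine integral_congr_ae (Filter.Eventually.of_forall fun x => ?_)
  simp only
  rw [← Complex.exp_add]
  congr 1
  push_cast
  ring

theorem isSelfSimilarMeasure_unique {N : ℕ} (hN : 2 ≤ N) {D : Finset ℤ} {μ ν : Measure ℝ}
    (hμ : IsSelfSimilarMeasure N D μ) (hν : IsSelfSimilarMeasure N D ν) : μ = ν := by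
  have := hμ.isProbabilityMeasure
  have := hν.isProbabilityMeasure
  have hM : ∀ t : ℝ, ‖∑ d ∈ D, (D.card : ℂ)⁻¹ * Complex.exp (t * (d / N) * Complex.I)‖ ≤ 1 := by
    intro t
    refine (norm_sum_le _ _).trans ?_
    have h1 : ∀ d ∈ D, ‖(D.card : ℂ)⁻¹ * Complex.exp (t * (d / N) * Complex.I)‖ =
        (D.card : ℝ)⁻¹ := by
      intro d _
      have : (t * (d / N) * Complex.I : ℂ) = ((t * (d / N) : ℝ) : ℂ) * Complex.I := by
        push_cast
        ring
      rw [norm_mul, this, Complex.norm_exp_ofReal_mul_I, mul_one, norm_inv, Complex.norm_natCast]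
    rw [Finset.sum_congr rfl h1, Finset.sum_const, nsmul_eq_mul]
    exact mul_inv_le_one
  set f : ℝ → ℂ := fun t => charFun μ t - charFun ν t with hf
  have hle : ∀ t, ‖f t‖ ≤ ‖f (t / N)‖ := by
    intro t
    simp only [hf]
    rw [hμ.charFun_eq t, hν.charFun_eq t, ← mul_sub, norm_mul]
    exact mul_le_of_le_one_left (norm_nonneg _) (hM t)
  have hiter : ∀ (k : ℕ) (t : ℝ), ‖f t‖ ≤ ‖f (t / (N : ℝ) ^ k)‖ := by
    intro k t
    induction k with
    | zero => simp
    | succ k ih =>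
      refine ih.trans ((hle _).trans_eq ?_)
      rw [div_div, ← pow_succ]
  have hcont : Continuous f := by
    have h1 : Continuous (charFun μ) := continuous_charFun
    have h2 : Continuous (charFun ν) := continuous_charFun
    exact h1.sub h2
  have hf0 : f 0 = 0 := by simp [hf, charFun_zero]
  refine Measure.ext_of_charFun (funext fun t => sub_eq_zero.1 ?_)
  have hN1 : (1 : ℝ) < N := by exact_mod_cast (by omega : 1 < N)
  have hlim : Filter.Tendsto (fun k : ℕ => t / (N : ℝ) ^ k) Filter.atTop (nhds 0) :=
    (tendsto_pow_atTop_atTop_of_one_lt hN1).const_div_atTop t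
  have hlim2 : Filter.Tendsto (fun k : ℕ => ‖f (t / (N : ℝ) ^ k)‖) Filter.atTop (nhds 0) := by
    have := ((hcont.tendsto 0).comp hlim).norm
    rwa [hf0, norm_zero] at this
  exact norm_le_zero_iff.1 (ge_of_tendsto' hlim2 fun k => hiter k t)

/-- `selfSimilarMeasure N D` is the unique self-similar probability measure of `(N, D)`. -/
theorem isSelfSimilarMeasure_iff {N : ℕ} (hN : 2 ≤ N) {D : Finset ℤ} (hD : D.Nonempty)
    {μ : Measure ℝ} : IsSelfSimilarMeasure N D μ ↔ μ = selfSimilarMeasure N D := by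
  refine ⟨fun h => isSelfSimilarMeasure_unique hN h
    (isSelfSimilarMeasure_selfSimilarMeasure hN hD), ?_⟩
  rintro rfl
  exact isSelfSimilarMeasure_selfSimilarMeasure hN hD

end

noncomputable section

open Finset Filter Topology

/-! ### Transfer operators with a harmonic weight -/

/-! Let `φ = |μ̂|²`, with `μ̂(t) = ∫ e^{2πitx} dμ(x)`. By the Jorgensen–Pedersen criterion
(`isSpectralMeasure_of_hasSum`) it is enough to find a countable `Λ` with `∑_{λ ∈ Λ} φ(ξ + λ) = 1`
for every `ξ`.

For `r ≥ 1` the digit set need not belong to a Hadamard triple, so the transition weights `p(t) =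
∏_{i<r} |m_D(N^i t)|²` need not sum to `1` over the preimages `(y + l)/N^r`. There is a substitute
for the constant function. Put `w(t) = ∏_{i<r} q(N^i t)`, where `q` is the mean of `|m_{B_a}|²` over
`a ∈ A`. One has `m_D(t) = (#A)⁻¹ ∑_a m_{B_a}(N^r t) e^{2πiat}`, and the coefficients `m_{B_a}` are
`1`-periodic, so they do not change among the preimages of a given `y`. Parseval for `A ⊕ B_a` then
makes `w` harmonic, `∑ p w = w`, and Parseval for `A` alone gives `∑ p = (#L₂)^r w`. This second
relation controls the mass carried where `w` is small.

Iterating harmonicity yields finite families of frequencies that exhaust `w` exactly at level `K`.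
Passing to the limit needs tightness: where `w ≥ δ`, the tail `φ(·/M^K)` must be bounded below.
Moving frequencies by `M^K Γ` brings the tail close to its largest value on a coset of `Γ`, and
compactness gives the bound, provided that `φ` does not vanish on a whole coset where `w ≠ 0`
(`exists_translate_ne_zero`). Hence `∑_{λ ∈ Λ'} φ(ξ + λ) = w(ξ)` for some countable `Λ'`
(`exists_hasSum`).

Finally, Parseval for the `B_a` shows that finitely many translates of `w` sum to `1`; the
corresponding translates of `Λ'` make up the spectrum. For `r = 0` the same scheme runs with `w =
1`. -/

/-- The data of the random walk `y ↦ (y + l k) / M` with transition weights `p`, a harmonic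
weight `w`, and the infinite product `φ y = ∏ p (y / M ^ j)`. All functions are periodic with
respect to the subgroup `Γ`, which contains the digits `l k`. -/
structure IsHarmonicSystem {κ : Type} [Fintype κ] (M C : ℝ) (l : κ → ℝ) (Γ : AddSubgroup ℝ)
    (p w φ : ℝ → ℝ) : Prop where
  one_lt : 1 < M
  digit_mem : ∀ k, l k ∈ Γ
  one_mem : (1 : ℝ) ∈ Γ
  mul_mem : ∀ γ ∈ Γ, M * γ ∈ Γ
  p_nonneg : ∀ t, 0 ≤ p t
  p_le_one : ∀ t, p t ≤ 1
  p_add : ∀ t, ∀ γ ∈ Γ, p (t + γ) = p t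
  w_nonneg : ∀ t, 0 ≤ w t
  w_le_one : ∀ t, w t ≤ 1
  w_zero : w 0 = 1
  w_add : ∀ t, ∀ γ ∈ Γ, w (t + γ) = w t
  w_cont : UniformContinuous w
  φ_nonneg : ∀ t, 0 ≤ φ t
  φ_le_one : ∀ t, φ t ≤ 1
  φ_zero : φ 0 = 1
  φ_cont : UniformContinuous φ
  φ_mul : ∀ t, φ (M * t) = p t * φ t
  harmonic : ∀ y, ∑ k, p ((y + l k) / M) * w ((y + l k) / M) = w y
  bound : ∀ y, ∑ k, p ((y + l k) / M) ≤ C * w y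

/-- The partial product `∏_{1 ≤ j ≤ K} p (t / M ^ j)`. -/
def partialProduct (p : ℝ → ℝ) (M : ℝ) (K : ℕ) (t : ℝ) : ℝ :=
  ∏ j ∈ range K, p (t / M ^ (j + 1))

theorem partialProduct_succ (p : ℝ → ℝ) (M : ℝ) (K : ℕ) (t : ℝ) :
    partialProduct p M (K + 1) t = partialProduct p M K t * p (t / M ^ (K + 1)) :=
  prod_range_succ _ _

namespace IsHarmonicSystem

variable {κ : Type} [Fintype κ] {M C : ℝ} {l : κ → ℝ} {Γ : AddSubgroup ℝ} {p w φ : ℝ → ℝ}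

theorem pos (h : IsHarmonicSystem M C l Γ p w φ) : 0 < M := zero_lt_one.trans h.one_lt

theorem pow_ne_zero (h : IsHarmonicSystem M C l Γ p w φ) (K : ℕ) : M ^ K ≠ 0 :=
  (pow_pos h.pos K).ne'

theorem pow_mul_mem (h : IsHarmonicSystem M C l Γ p w φ) (K : ℕ) {γ : ℝ} (hγ : γ ∈ Γ) :
    M ^ K * γ ∈ Γ := by
  induction K with
  | zero => simpa using hγ
  | succ K ih =>
    rw [pow_succ', mul_assoc]
    exact h.mul_mem _ ih

theorem p_zero (h : IsHarmonicSystem M C l Γ p w φ) : p 0 = 1 := by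
  have := h.φ_mul 0
  rwa [mul_zero, h.φ_zero, mul_one, eq_comm] at this

theorem partialProduct_nonneg (h : IsHarmonicSystem M C l Γ p w φ) (K : ℕ) (t : ℝ) :
    0 ≤ partialProduct p M K t :=
  prod_nonneg fun _ _ => h.p_nonneg _

theorem partialProduct_zero_right (h : IsHarmonicSystem M C l Γ p w φ) (K : ℕ) :
    partialProduct p M K 0 = 1 := by
  simp [partialProduct, h.p_zero]

theorem partialProduct_add (h : IsHarmonicSystem M C l Γ p w φ) (K : ℕ) (t : ℝ) {γ : ℝ}
    (hγ : γ ∈ Γ) : partialProduct p M K (t + M ^ K * γ) = partialProduct p M K t := by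
  refine prod_congr rfl fun j hj => ?_
  obtain ⟨i, rfl⟩ : ∃ i, K = (j + 1) + i := ⟨K - (j + 1), by have := mem_range.1 hj; omega⟩
  have : (t + M ^ (j + 1 + i) * γ) / M ^ (j + 1) = t / M ^ (j + 1) + M ^ i * γ := by
    have := h.pow_ne_zero (j + 1)
    rw [pow_add]
    field_simp
  rw [this, h.p_add _ _ (h.pow_mul_mem i hγ)]

theorem φ_eq_partialProduct (h : IsHarmonicSystem M C l Γ p w φ) (K : ℕ) (t : ℝ) :
    φ t = partialProduct p M K t * φ (t / M ^ K) := by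
  induction K with
  | zero => simp [partialProduct]
  | succ K ih =>
    have h1 : t / M ^ K = M * (t / M ^ (K + 1)) := by
      have := h.pow_ne_zero K
      have := h.pos.ne'
      rw [pow_succ]
      field_simp
    rw [partialProduct_succ, ih, h1, h.φ_mul, mul_assoc]

theorem tendsto_div_pow (h : IsHarmonicSystem M C l Γ p w φ) (t : ℝ) :
    Tendsto (fun K : ℕ => t / M ^ K) atTop (𝓝 0) :=
  (tendsto_pow_atTop_atTop_of_one_lt h.one_lt).const_div_atTop t

/-- In `φ t = P_K(t) φ(t / M ^ K)` the last factor tends to `φ 0 = 1`; dividing by it also covers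
the zeros of `φ`. -/
theorem tendsto_partialProduct (h : IsHarmonicSystem M C l Γ p w φ) (t : ℝ) :
    Tendsto (fun K => partialProduct p M K t) atTop (𝓝 (φ t)) := by
  have h1 : Tendsto (fun K : ℕ => φ (t / M ^ K)) atTop (𝓝 1) := by
    have := (h.φ_cont.continuous.tendsto 0).comp (h.tendsto_div_pow t)
    rwa [h.φ_zero] at this
  have h2 : Tendsto (fun K : ℕ => φ t / φ (t / M ^ K)) atTop (𝓝 (φ t / 1)) :=
    tendsto_const_nhds.div h1 one_ne_zero
  rw [div_one] at h2
  refine h2.congr' ?_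
  filter_upwards [h1.eventually_ne one_ne_zero] with K hK
  rw [h.φ_eq_partialProduct K t, mul_div_cancel_right₀ _ hK]

/-! ### Finite exhausting families of frequencies -/

/-- A finite family of frequencies that exhausts the weight `w` at level `K`. -/
def IsExhausting (M : ℝ) (p w : ℝ → ℝ) {ι : Type*} (s : Finset ι) (K : ℕ) (f : ι → ℝ) : Prop :=
  ∀ ξ, ∑ i ∈ s, partialProduct p M K (ξ + f i) * w ((ξ + f i) / M ^ K) = w ξ

/-- The total transition weight of a finite family at level `K` is dominated by `w`. -/
def IsDominated (M C : ℝ) (p w : ℝ → ℝ) {ι : Type*} (s : Finset ι) (K : ℕ) (f : ι → ℝ) : Prop :=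
  ∀ ξ, ∑ i ∈ s, partialProduct p M K (ξ + f i) ≤ C * w ξ

/-- A repeated frequency would contribute `w 0 = 1` twice at `ξ = -f i`, against `w ≤ 1`. This lets
indexed families be replaced by sets. -/
theorem IsExhausting.injOn (h : IsHarmonicSystem M C l Γ p w φ) {ι : Type*} {s : Finset ι}
    {K : ℕ} {f : ι → ℝ} (hf : IsExhausting M p w s K f) : Set.InjOn f s := by
  classical
  intro i hi j hj hij
  by_contra hne
  have h1 := hf (-f i)
  have h2 : ∑ x ∈ ({i, j} : Finset ι),
      partialProduct p M K (-f i + f x) * w ((-f i + f x) / M ^ K) ≤ w (-f i) := by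
    rw [← h1]
    refine sum_le_sum_of_subset_of_nonneg ?_ fun x _ _ =>
      mul_nonneg (h.partialProduct_nonneg _ _) (h.w_nonneg _)
    intro x hx
    simp only [mem_insert, mem_singleton] at hx
    rcases hx with rfl | rfl
    exacts [hi, hj]
  rw [sum_pair hne, ← hij] at h2
  simp only [neg_add_cancel, h.partialProduct_zero_right, zero_div, h.w_zero] at h2
  linarith [h.w_le_one (-f i)]

theorem IsExhausting.image (h : IsHarmonicSystem M C l Γ p w φ) {ι : Type*} {s : Finset ι}
    {K : ℕ} {f : ι → ℝ} (hf : IsExhausting M p w s K f) :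
    IsExhausting M p w (s.image f) K id := by
  intro ξ
  rw [sum_image (hf.injOn h)]
  exact hf ξ

theorem IsDominated.image (h : IsHarmonicSystem M C l Γ p w φ) {ι : Type*} {s : Finset ι}
    {K : ℕ} {f : ι → ℝ} (hf : IsExhausting M p w s K f) (hd : IsDominated M C p w s K f) :
    IsDominated M C p w (s.image f) K id := by
  intro ξ
  rw [sum_image (hf.injOn h)]
  exact hd ξ

/-- Only the last factor of the product depends on the new digit, so harmonicity collapses the inner
sum. Domination uses `bound` on this last step alone and exhaustion before it, so `C` does not grow
with the level. -/
theorem IsExhausting.extend (h : IsHarmonicSystem M C l Γ p w φ) {F : Finset ℝ} {K : ℕ}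
    (hF : IsExhausting M p w F K id) :
    IsExhausting M p w (F ×ˢ (univ : Finset κ)) (K + 1) (fun x => x.1 + M ^ K * l x.2) ∧
      IsDominated M C p w (F ×ˢ (univ : Finset κ)) (K + 1) (fun x => x.1 + M ^ K * l x.2) := by
  have key : ∀ ξ a : ℝ, ∀ k, partialProduct p M (K + 1) (ξ + (a + M ^ K * l k)) =
      partialProduct p M K (ξ + a) * p (((ξ + a) / M ^ K + l k) / M) ∧
      (ξ + (a + M ^ K * l k)) / M ^ (K + 1) = ((ξ + a) / M ^ K + l k) / M := by
    intro ξ a k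
    have h2 : (ξ + (a + M ^ K * l k)) / M ^ (K + 1) = ((ξ + a) / M ^ K + l k) / M := by
      have := h.pow_ne_zero K
      have := h.pos.ne'
      rw [pow_succ]
      field_simp
      ring
    refine ⟨?_, h2⟩
    rw [partialProduct_succ, h2, ← add_assoc, h.partialProduct_add _ _ (h.digit_mem k)]
  constructor
  · intro ξ
    rw [sum_product]
    refine Eq.trans ?_ (hF ξ)
    refine sum_congr rfl fun a _ => ?_
    simp only [id, (key ξ a _).1, (key ξ a _).2, mul_assoc]
    rw [← mul_sum, h.harmonic]
  · intro ξ
    rw [sum_product, ← hF ξ, mul_sum]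
    refine sum_le_sum fun a _ => ?_
    simp only [id, (key ξ a _).1]
    rw [← mul_sum, mul_left_comm]
    exact mul_le_mul_of_nonneg_left (h.bound _) (h.partialProduct_nonneg _ _)

/-- A shift by `M ^ K * z` with `z ∈ Γ` leaves every factor up to level `K` unchanged and moves only
the tail `φ (· / M ^ K)`. This is the freedom used to keep the tail large. -/
theorem IsExhausting.adjust (h : IsHarmonicSystem M C l Γ p w φ) {F : Finset ℝ} {K : ℕ}
    (hF : IsExhausting M p w F K id) (hd : IsDominated M C p w F K id) {z : ℝ → ℝ}
    (hz : ∀ x, z x ∈ Γ) :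
    IsExhausting M p w F K (fun x => x + M ^ K * z x) ∧
      IsDominated M C p w F K (fun x => x + M ^ K * z x) := by
  have key : ∀ ξ x : ℝ, (ξ + (x + M ^ K * z x)) / M ^ K = (ξ + x) / M ^ K + z x := by
    intro ξ x
    have := h.pow_ne_zero K
    field_simp
    ring
  constructor
  · intro ξ
    refine Eq.trans (sum_congr rfl fun x _ => ?_) (hF ξ)
    rw [key, h.w_add _ _ (hz x), ← add_assoc, h.partialProduct_add _ _ (hz x), id]
  · intro ξ
    refine le_trans (le_of_eq (sum_congr rfl fun x _ => ?_)) (hd ξ)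
    rw [← add_assoc, h.partialProduct_add _ _ (hz x), id]

/-- The zero digit keeps every old frequency in the family. At least one step is taken, since only
an extended family is known to be dominated. -/
theorem exists_extend (h : IsHarmonicSystem M C l Γ p w φ) {k₀ : κ} (hk₀ : l k₀ = 0)
    {F : Finset ℝ} {K : ℕ} (hF : IsExhausting M p w F K id) (m : ℕ) :
    ∃ F', F ⊆ F' ∧ IsExhausting M p w F' (K + m + 1) id ∧
      IsDominated M C p w F' (K + m + 1) id := by
  classical
  have step : ∀ {F : Finset ℝ} {K : ℕ}, IsExhausting M p w F K id →
      ∃ F', F ⊆ F' ∧ IsExhausting M p w F' (K + 1) id ∧ IsDominated M C p w F' (K + 1) id := by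
    intro F K hF
    obtain ⟨h1, h2⟩ := hF.extend h
    refine ⟨_, fun x hx => ?_, h1.image h, h2.image h h1⟩
    exact mem_image.2 ⟨(x, k₀), by simp [hx], by simp [hk₀]⟩
  induction m with
  | zero => exact step hF
  | succ m ih =>
    obtain ⟨F', h1, h2, -⟩ := ih
    obtain ⟨F'', h3, h4⟩ := step h2
    exact ⟨F'', h1.trans h3, h4⟩

/-- The supremum over a coset need not be attained, hence the factor `2`; if `φ` vanishes on the
coset any translate will do. -/
theorem exists_near_max (h : IsHarmonicSystem M C l Γ p w φ) (x : ℝ) :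
    ∃ z ∈ Γ, ∀ z' ∈ Γ, φ (x + z') ≤ 2 * φ (x + z) := by
  by_cases h0 : ∃ z ∈ Γ, 0 < φ (x + z)
  · obtain ⟨z₀, hz₀, hpos⟩ := h0
    set S : Set ℝ := (fun z => φ (x + z)) '' (Γ : Set ℝ)
    have hb : BddAbove S := ⟨1, by rintro _ ⟨z, _, rfl⟩; exact h.φ_le_one _⟩
    have hS : 0 < sSup S := hpos.trans_le (le_csSup hb ⟨z₀, hz₀, rfl⟩)
    obtain ⟨_, ⟨z, hz, rfl⟩, hlt⟩ := exists_lt_of_lt_csSup (⟨_, z₀, hz₀, rfl⟩ : S.Nonempty)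
      (half_lt_self hS)
    refine ⟨z, hz, fun z' hz' => ?_⟩
    have := le_csSup hb (⟨z', hz', rfl⟩ : φ (x + z') ∈ S)
    simp only at hlt
    linarith
  · push Not at h0
    exact ⟨0, Γ.zero_mem, fun z' hz' => (h0 z' hz').trans (by linarith [h.φ_nonneg (x + 0)])⟩

/-- Old frequencies must stay put, but become small after division by a large power of `M`; new ones
are free to be moved to a nearly maximal tail. -/
theorem exists_stage (h : IsHarmonicSystem M C l Γ p w φ) {k₀ : κ} (hk₀ : l k₀ = 0)
    {F : Finset ℝ} {K : ℕ} (hF : IsExhausting M p w F K id) {τ : ℝ} (hτ : 0 < τ) :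
    ∃ (K' : ℕ) (F' : Finset ℝ), K < K' ∧ F ⊆ F' ∧ IsExhausting M p w F' K' id ∧
      IsDominated M C p w F' K' id ∧
      ∀ x ∈ F', |x / M ^ K'| ≤ τ ∨ ∀ z ∈ Γ, φ (x / M ^ K' + z) ≤ 2 * φ (x / M ^ K') := by
  classical
  have hev : ∀ᶠ m : ℕ in atTop, ∀ x ∈ F, |x / M ^ (K + m + 1)| ≤ τ := by
    rw [eventually_all_finset]
    intro x _
    have h1 : Tendsto (fun m : ℕ => |x / M ^ (K + m + 1)|) atTop (𝓝 0) := by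
      have h2 : Tendsto (fun m : ℕ => K + m + 1) atTop atTop :=
        
        tendsto_atTop_mono (fun m => (by omega : m ≤ K + m + 1)) tendsto_id
      have := ((h.tendsto_div_pow x).comp h2).abs
      rwa [abs_zero] at this
    exact (h1.eventually_lt_const hτ).mono fun _ => le_of_lt
  obtain ⟨m, hm⟩ := hev.exists
  obtain ⟨F', hsub, h1, h2⟩ := h.exists_extend hk₀ hF m
  set K' := K + m + 1
  choose ζ hζ hmax using h.exists_near_max
  set z : ℝ → ℝ := fun x => if x ∈ F then 0 else ζ (x / M ^ K') with hz
  have hzΓ : ∀ x, z x ∈ Γ := by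
    intro x
    simp only [hz]
    split_ifs
    exacts [Γ.zero_mem, hζ _]
  obtain ⟨h3, h4⟩ := h1.adjust h h2 hzΓ
  refine ⟨K', _, by omega, fun x hx => ?_, h3.image h, h4.image h h3, ?_⟩
  · exact mem_image.2 ⟨x, hsub hx, by simp [hz, hx]⟩
  · intro y hy
    obtain ⟨x, hx, rfl⟩ := mem_image.1 hy
    by_cases hxF : x ∈ F
    · left
      simpa [hz, hxF] using hm x hxF
    · right
      have hq : (x + M ^ K' * z x) / M ^ K' = x / M ^ K' + ζ (x / M ^ K') := by
        have := h.pow_ne_zero K'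
        simp only [hz, hxF, if_false]
        field_simp
      intro γ hγ
      rw [hq, add_assoc]
      exact hmax _ _ (Γ.add_mem (hζ _) hγ)

/-- On the set where the weight is bounded below, some translate of `φ` is bounded below. -/
theorem exists_uniform_lower_bound (h : IsHarmonicSystem M C l Γ p w φ)
    (hnz : ∀ y, w y ≠ 0 → ∃ z ∈ Γ, φ (y + z) ≠ 0) {δ : ℝ} (hδ : 0 < δ) :
    ∃ ε > 0, ∀ x, δ ≤ w x → ∃ z ∈ Γ, ε ≤ φ (x + z) := by
  have hcomp : IsCompact (Set.Icc (0 : ℝ) 1 ∩ {x | δ ≤ w x}) :=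
    isCompact_Icc.inter_right (isClosed_le continuous_const h.w_cont.continuous)
  -- A lower bound on one translate persists nearby, and compactness leaves finitely many such
  -- bounds.
  have hkey : ∃ ε > 0, ∀ x ∈ Set.Icc (0 : ℝ) 1 ∩ {x | δ ≤ w x}, ∃ z ∈ Γ, ε ≤ φ (x + z) := by
    refine hcomp.induction_on (p := fun S => ∃ ε > 0, ∀ x ∈ S, ∃ z ∈ Γ, ε ≤ φ (x + z))
      ⟨1, one_pos, by simp⟩ ?_ ?_ ?_
    · rintro S T hST ⟨ε, hε, hT⟩
      exact ⟨ε, hε, fun x hx => hT x (hST hx)⟩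
    · rintro S T ⟨ε, hε, hS⟩ ⟨η, hη, hT⟩
      refine ⟨min ε η, lt_min hε hη, ?_⟩
      rintro x (hx | hx)
      · obtain ⟨z, hz, hle⟩ := hS x hx
        exact ⟨z, hz, (min_le_left _ _).trans hle⟩
      · obtain ⟨z, hz, hle⟩ := hT x hx
        exact ⟨z, hz, (min_le_right _ _).trans hle⟩
    · rintro x ⟨_, hx⟩
      obtain ⟨z, hz, hne⟩ := hnz x (hδ.trans_le hx).ne'
      have hpos : 0 < φ (x + z) := lt_of_le_of_ne (h.φ_nonneg _) hne.symm
      refine ⟨{y | φ (x + z) / 2 < φ (y + z)}, mem_nhdsWithin_of_mem_nhds ?_,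
        φ (x + z) / 2, half_pos hpos, fun y hy => ⟨z, hz, le_of_lt hy⟩⟩
      have hc : Continuous fun y => φ (y + z) :=
        h.φ_cont.continuous.comp (continuous_id.add continuous_const)
      exact hc.continuousAt.eventually (lt_mem_nhds (half_lt_self hpos))
  obtain ⟨ε, hε, hε'⟩ := hkey
  refine ⟨ε, hε, fun x hx => ?_⟩
  have hfl : (⌊x⌋ : ℝ) ∈ Γ := by
    have := Γ.zsmul_mem h.one_mem ⌊x⌋
    simpa using this
  obtain ⟨z, hz, hle⟩ := hε' (Int.fract x) ⟨⟨Int.fract_nonneg x, (Int.fract_lt_one x).le⟩, by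
    have : Int.fract x = x + -(⌊x⌋ : ℝ) := by rw [← Int.self_sub_floor, sub_eq_add_neg]
    rw [Set.mem_ofPred_eq, this, h.w_add _ _ (Γ.neg_mem hfl)]
    exact hx⟩
  refine ⟨z - ⌊x⌋, Γ.sub_mem hz hfl, hle.trans_eq ?_⟩
  rw [← Int.self_sub_floor]
  congr 1
  ring

theorem exists_stages (h : IsHarmonicSystem M C l Γ p w φ) {k₀ : κ} (hk₀ : l k₀ = 0) :
    ∃ (K : ℕ → ℕ) (F : ℕ → Finset ℝ), StrictMono K ∧ Monotone F ∧
      (∀ n, IsExhausting M p w (F n) (K n) id) ∧ (∀ n, IsDominated M C p w (F n) (K n) id) ∧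
      ∀ n, ∀ x ∈ F n, |x / M ^ K n| ≤ 1 / ((n : ℝ) + 1) ∨
        ∀ z ∈ Γ, φ (x / M ^ K n + z) ≤ 2 * φ (x / M ^ K n) := by
  have h0 : IsExhausting M p w ({0} : Finset ℝ) 0 id := by
    intro ξ
    simp [partialProduct]
  have hstage : ∀ (n : ℕ) (s : {s : ℕ × Finset ℝ // IsExhausting M p w s.2 s.1 id}),
      ∃ s' : {s : ℕ × Finset ℝ // IsExhausting M p w s.2 s.1 id}, s.1.1 < s'.1.1 ∧
        s.1.2 ⊆ s'.1.2 ∧ IsDominated M C p w s'.1.2 s'.1.1 id ∧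
        ∀ x ∈ s'.1.2, |x / M ^ s'.1.1| ≤ 1 / ((n : ℝ) + 1) ∨
          ∀ z ∈ Γ, φ (x / M ^ s'.1.1 + z) ≤ 2 * φ (x / M ^ s'.1.1) := by
    intro n s
    obtain ⟨K', F', h1, h2, h3, h4, h5⟩ :=
      h.exists_stage hk₀ s.2 (τ := 1 / ((n : ℝ) + 1)) (by positivity)
    exact ⟨⟨(K', F'), h3⟩, h1, h2, h4, h5⟩
  choose next hK hF hD hN using hstage
  let s : ℕ → {s : ℕ × Finset ℝ // IsExhausting M p w s.2 s.1 id} := fun n =>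
    Nat.rec ⟨(0, {0}), h0⟩ next n
  have hs : ∀ n, s (n + 1) = next n (s n) := fun n => rfl
  -- The index is shifted because the initial family `{0}` at level `0` carries no domination bound.
  refine ⟨fun n => (s (n + 1)).1.1, fun n => (s (n + 1)).1.2, strictMono_nat_of_lt_succ fun n => ?_,
    monotone_nat_of_le_succ fun n => ?_, fun n => (s (n + 1)).2, fun n => ?_, fun n => ?_⟩
  · rw [hs (n + 1)]; exact hK _ _
  · rw [hs (n + 1)]; exact hF _ _
  · exact hD _ _
  · exact hN _ _

/-- Fixed finite sets of frequencies give the upper bound in the limit. For the lower bound, mass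
where `w < δ` costs at most `δ * C`, and elsewhere the tail of `φ` is bounded below, so that the
mass is dominated by the summable family `φ (ξ + x)`. -/
theorem exists_hasSum_of_digit_eq_zero (h : IsHarmonicSystem M C l Γ p w φ) {k₀ : κ}
    (hk₀ : l k₀ = 0) (hnz : ∀ y, w y ≠ 0 → ∃ z ∈ Γ, φ (y + z) ≠ 0) :
    ∃ Λ : Set ℝ, Λ.Countable ∧ ∀ ξ, HasSum (fun x : Λ => φ (ξ + x)) (w ξ) := by
  classical
  obtain ⟨K, F, hK, hF, hE, hD, hN⟩ := h.exists_stages hk₀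
  set Λ : Set ℝ := ⋃ n, (F n : Set ℝ) with hΛ
  refine ⟨Λ, Set.countable_iUnion fun n => (F n).countable_toSet, fun ξ => ?_⟩
  have hFΛ : ∀ n, ∀ x ∈ F n, x ∈ Λ := fun n x hx => Set.mem_iUnion.2 ⟨n, hx⟩
  have hC : 0 ≤ C := by
    have := (sum_nonneg fun k _ => h.p_nonneg _).trans (h.bound 0)
    rwa [h.w_zero, mul_one] at this
  have hKtop : Tendsto K atTop atTop := hK.tendsto_atTop
  have hpp : ∀ x, Tendsto (fun n => partialProduct p M (K n) (ξ + x)) atTop (𝓝 (φ (ξ + x))) :=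
    fun x => (h.tendsto_partialProduct _).comp hKtop
  have hww : ∀ x, Tendsto (fun n => w ((ξ + x) / M ^ K n)) atTop (𝓝 1) := by
    intro x
    have := (h.w_cont.continuous.tendsto 0).comp ((h.tendsto_div_pow (ξ + x)).comp hKtop)
    rwa [h.w_zero] at this
  set g : ℝ → ℝ := Λ.indicator fun x => φ (ξ + x) with hg
  have hg0 : ∀ x, 0 ≤ g x := fun x => Set.indicator_nonneg (fun _ _ => h.φ_nonneg _) x
  have hgΛ : ∀ x ∈ Λ, g x = φ (ξ + x) := fun x hx => Set.indicator_of_mem hx _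
  have hsub : ∀ T : Finset ℝ, (∀ x ∈ T, x ∈ Λ) → ∀ᶠ n in atTop, T ⊆ F n := by
    intro T hT
    have : ∀ x ∈ T, ∀ᶠ n in atTop, x ∈ F n := by
      intro x hx
      obtain ⟨n, hn⟩ := Set.mem_iUnion.1 (hT x hx)
      filter_upwards [eventually_ge_atTop n] with m hm
      exact hF hm hn
    exact (eventually_all_finset T).2 this
  have hupper : ∀ T : Finset ℝ, ∑ x ∈ T, g x ≤ w ξ := by
    intro T
    have h1 : ∑ x ∈ T, g x = ∑ x ∈ T.filter (· ∈ Λ), φ (ξ + x) := by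
      rw [sum_filter]
      rfl
    rw [h1]
    have h2 : Tendsto (fun n => ∑ x ∈ T.filter (· ∈ Λ),
        partialProduct p M (K n) (ξ + x) * w ((ξ + x) / M ^ K n)) atTop
        (𝓝 (∑ x ∈ T.filter (· ∈ Λ), φ (ξ + x))) := by
      refine tendsto_finsetSum _ fun x _ => ?_
      simpa using (hpp x).mul (hww x)
    refine le_of_tendsto h2 ?_
    filter_upwards [hsub (T.filter (· ∈ Λ)) fun x hx => (mem_filter.1 hx).2] with n hn
    rw [← hE n ξ]
    exact sum_le_sum_of_subset_of_nonneg hn fun x _ _ =>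
      mul_nonneg (h.partialProduct_nonneg _ _) (h.w_nonneg _)
  have hsum : Summable g := summable_of_sum_le hg0 hupper
  have hlower : w ξ ≤ ∑' x, g x := by
    refine le_of_forall_pos_le_add fun η hη => ?_
    -- Chosen so that the two errors `δ * C` and `δ` add up to `η`.
    set δ : ℝ := η / (C + 1) with hδdef
    have hδ : 0 < δ := by positivity
    obtain ⟨ε, hε, hεw⟩ := h.exists_uniform_lower_bound hnz (half_pos hδ)
    obtain ⟨η₁, hη₁, h₁⟩ := Metric.uniformContinuous_iff.1 h.w_cont (δ / 2) (half_pos hδ)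
    obtain ⟨η₂, hη₂, h₂⟩ := Metric.uniformContinuous_iff.1 h.φ_cont (ε / 4) (by positivity)
    obtain ⟨η₃, hη₃, h₃⟩ := Metric.uniformContinuous_iff.1 h.φ_cont (1 / 2) (by norm_num)
    set ε' : ℝ := min (ε / 4) (1 / 2)
    have hε' : 0 < ε' := lt_min (by positivity) (by norm_num)
    have hξ : Tendsto (fun n => |ξ / M ^ K n|) atTop (𝓝 0) := by
      have := ((h.tendsto_div_pow ξ).comp hKtop).abs
      rwa [abs_zero] at this
    -- Small frequencies have tail near `φ 0 = 1`. For the others, near-maximality gives `φ (x / M ^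
    -- K n) ≥ ε / 2`, and the shift by `ξ / M ^ K n` costs at most `ε / 4`.
    have hgood : ∀ᶠ n in atTop, ∀ x ∈ F n, δ ≤ w ((ξ + x) / M ^ K n) →
        ε' ≤ φ ((ξ + x) / M ^ K n) := by
      filter_upwards [hξ.eventually_lt_const hη₁, hξ.eventually_lt_const hη₂,
        hξ.eventually_lt_const (half_pos hη₃),
        tendsto_one_div_add_atTop_nhds_zero_nat.eventually_lt_const (half_pos hη₃)]
        with n hn₁ hn₂ hn₃ hn₄ x hx hδx
      have hsplit : (ξ + x) / M ^ K n = ξ / M ^ K n + x / M ^ K n := add_div _ _ _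
      rw [hsplit] at hδx ⊢
      rcases hN n x hx with hsmall | hmax
      · have hd : dist (ξ / M ^ K n + x / M ^ K n) 0 < η₃ := by
          rw [Real.dist_eq, sub_zero]
          calc _ ≤ |ξ / M ^ K n| + |x / M ^ K n| := abs_add_le _ _
            _ < η₃ := by linarith
        have := h₃ hd
        rw [h.φ_zero, Real.dist_eq] at this
        have := (abs_lt.1 this).1
        exact (min_le_right _ _).trans (by linarith)
      · have hd : dist (ξ / M ^ K n + x / M ^ K n) (x / M ^ K n) = |ξ / M ^ K n| := by
          rw [Real.dist_eq, add_sub_cancel_right]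
        have e1 := h₁ (hd.trans_lt hn₁)
        have e2 := h₂ (hd.trans_lt hn₂)
        rw [Real.dist_eq] at e1 e2
        have e1' := (abs_lt.1 e1).2
        have e2' := (abs_lt.1 e2).1
        obtain ⟨z, hz, hle⟩ := hεw (x / M ^ K n) (by linarith)
        have := hmax z hz
        exact (min_le_left _ _).trans (by linarith)
    obtain ⟨T, hT⟩ := summable_iff_vanishing_norm.1 hsum (ε' * δ) (by positivity)
    set T' := T.filter (· ∈ Λ)
    have hlim : Tendsto (fun n => ∑ x ∈ T', partialProduct p M (K n) (ξ + x) + η) atTop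
        (𝓝 (∑ x ∈ T', φ (ξ + x) + η)) :=
      (tendsto_finsetSum _ fun x _ => hpp x).add_const η
    have hT' : ∑ x ∈ T', φ (ξ + x) ≤ ∑' x, g x := by
      rw [← sum_congr rfl fun x hx => hgΛ x (mem_filter.1 hx).2]
      exact hsum.sum_le_tsum _ fun x _ => hg0 x
    refine le_trans (ge_of_tendsto hlim ?_) (by linarith)
    filter_upwards [hgood] with n hn
    have hrest : ∑ x ∈ F n \ T', g x ≤ ε' * δ := by
      refine (le_abs_self _).trans (hT _ ?_).le
      rw [disjoint_left]
      intro x hx hxT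
      rw [Finset.mem_sdiff] at hx
      exact hx.2 (mem_filter.2 ⟨hxT, hFΛ n x hx.1⟩)
    -- The two summands cover the cases `w < δ` and `w ≥ δ`, the second by `φ = P_K · φ(· / M ^ K) ≥
    -- ε' P_K`.
    have hterm : ∀ x ∈ F n \ T',
        partialProduct p M (K n) (ξ + x) * w ((ξ + x) / M ^ K n) ≤
          δ * partialProduct p M (K n) (ξ + x) + g x / ε' := by
      intro x hx
      have hxF := (Finset.mem_sdiff.1 hx).1
      have hp0 := h.partialProduct_nonneg (K n) (ξ + x)
      by_cases hw : δ ≤ w ((ξ + x) / M ^ K n)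
      · have h4 := hn x hxF hw
        have h5 : partialProduct p M (K n) (ξ + x) ≤ g x / ε' := by
          rw [le_div_iff₀ hε', hgΛ x (hFΛ n x hxF), h.φ_eq_partialProduct (K n)]
          exact mul_le_mul_of_nonneg_left h4 hp0
        have h6 : partialProduct p M (K n) (ξ + x) * w ((ξ + x) / M ^ K n) ≤
            partialProduct p M (K n) (ξ + x) := mul_le_of_le_one_right hp0 (h.w_le_one _)
        have : 0 ≤ δ * partialProduct p M (K n) (ξ + x) := by positivity
        linarith
      · have h5 : partialProduct p M (K n) (ξ + x) * w ((ξ + x) / M ^ K n) ≤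
            δ * partialProduct p M (K n) (ξ + x) := by
          rw [mul_comm δ]
          exact mul_le_mul_of_nonneg_left (not_le.1 hw).le hp0
        have : 0 ≤ g x / ε' := div_nonneg (hg0 x) hε'.le
        linarith
    have hall : w ξ ≤ ∑ x ∈ T', partialProduct p M (K n) (ξ + x) +
        ∑ x ∈ F n \ T', partialProduct p M (K n) (ξ + x) * w ((ξ + x) / M ^ K n) := by
      rw [← hE n ξ, ← sum_inter_add_sum_sdiff (F n) T']
      refine add_le_add ?_ le_rfl
      refine (sum_le_sum fun x _ => mul_le_of_le_one_right (h.partialProduct_nonneg _ _)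
        (h.w_le_one _)).trans ?_
      exact sum_le_sum_of_subset_of_nonneg inter_subset_right fun x _ _ =>
        h.partialProduct_nonneg _ _
    have hsum2 : ∑ x ∈ F n \ T', partialProduct p M (K n) (ξ + x) * w ((ξ + x) / M ^ K n) ≤
        η := by
      refine (sum_le_sum hterm).trans ?_
      rw [sum_add_distrib, ← mul_sum, ← sum_div]
      have h7 : ∑ x ∈ F n \ T', partialProduct p M (K n) (ξ + x) ≤ C := by
        refine (sum_le_sum_of_subset_of_nonneg sdiff_subset fun x _ _ =>
          h.partialProduct_nonneg _ _).trans ((hD n ξ).trans ?_)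
        exact mul_le_of_le_one_right hC (h.w_le_one _)
      have h8 : (∑ x ∈ F n \ T', g x) / ε' ≤ δ := by
        rw [div_le_iff₀ hε', mul_comm]
        exact hrest
      have h9 : δ * C + δ = η := by
        rw [hδdef]
        field_simp
      have := mul_le_mul_of_nonneg_left h7 hδ.le
      linarith
    linarith
  have heq : ∑' x, g x = w ξ := le_antisymm (hsum.tsum_le_of_sum_le hupper) hlower
  exact (hasSum_subtype_iff_indicator (f := fun x => φ (ξ + x))).2 (heq ▸ hsum.hasSum)

/-- By `Γ`-invariance of `w`, the new relations at `y` are the old ones at `y - l k₀`. This makes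
`0` a digit. -/
theorem shift (h : IsHarmonicSystem M C l Γ p w φ) (k₀ : κ) :
    IsHarmonicSystem M C (fun k => l k - l k₀) Γ p w φ := by
  have hk : ∀ y k, y + (l k - l k₀) = y - l k₀ + l k := fun y k => by ring
  have hw : ∀ y, w (y - l k₀) = w y := fun y => by
    rw [sub_eq_add_neg, h.w_add _ _ (Γ.neg_mem (h.digit_mem k₀))]
  exact { h with
    digit_mem := fun k => Γ.sub_mem (h.digit_mem k) (h.digit_mem k₀)
    harmonic := fun y => by simp only [hk]; rw [h.harmonic, hw]
    bound := fun y => by simp only [hk]; rw [← hw y]; exact h.bound _ }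

theorem exists_digit (h : IsHarmonicSystem M C l Γ p w φ) : Nonempty κ := by
  by_contra hne
  rw [not_nonempty_iff] at hne
  have := h.harmonic 0
  rw [Fintype.sum_empty, h.w_zero] at this
  exact zero_ne_one this

/-- If `φ` does not vanish on any coset of `Γ` on which `w` is nonzero, then the weight `w` is
exhausted by the translates of `φ` by a countable set of frequencies. -/
theorem exists_hasSum (h : IsHarmonicSystem M C l Γ p w φ)
    (hnz : ∀ y, w y ≠ 0 → ∃ z ∈ Γ, φ (y + z) ≠ 0) :
    ∃ Λ : Set ℝ, Λ.Countable ∧ ∀ ξ, HasSum (fun x : Λ => φ (ξ + x)) (w ξ) := by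
  obtain ⟨k₀⟩ := h.exists_digit
  exact (h.shift k₀).exists_hasSum_of_digit_eq_zero (sub_self (l k₀)) hnz

/-! ### Nonvanishing of `φ` on cosets -/

/-- Two digits with the same preimage modulo `Γ` would both have weight `1` at `y = -l k'`,
exceeding `w ≤ 1`. -/
theorem digit_injective (h : IsHarmonicSystem M C l Γ p w φ) {k k' : κ}
    (hkk : (l k - l k') / M ∈ Γ) : k = k' := by
  classical
  by_contra hne
  have hM := h.pos.ne'
  have h1 := h.harmonic (-l k')
  have e1 : (-l k' + l k') / M = 0 := by simp
  have e2 : (-l k' + l k) / M = 0 + (l k - l k') / M := by ring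
  have h2 : ∑ x ∈ ({k, k'} : Finset κ), p ((-l k' + l x) / M) * w ((-l k' + l x) / M) ≤
      w (-l k') := by
    rw [← h1]
    exact sum_le_sum_of_subset_of_nonneg (subset_univ _) fun x _ _ =>
      mul_nonneg (h.p_nonneg _) (h.w_nonneg _)
  rw [sum_pair hne, e1, e2, h.p_add _ _ hkk, h.w_add _ _ hkk, h.p_zero, h.w_zero] at h2
  linarith [h.w_le_one (-l k')]

/-- If `φ` has finitely many zeros in the unit interval and `p η = p (M η) = 1` only when
`M η ∈ Γ`, then `φ` does not vanish identically on a coset of `Γ` on which `w` is nonzero. -/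
theorem exists_translate_ne_zero (h : IsHarmonicSystem M C l Γ p w φ)
    (hfin : {y | y ∈ Set.Icc (0 : ℝ) 1 ∧ φ y = 0}.Finite)
    (hrig : ∀ η, p η = 1 → p (M * η) = 1 → M * η ∈ Γ) (y : ℝ) (hy : w y ≠ 0) :
    ∃ z ∈ Γ, φ (y + z) ≠ 0 := by
  classical
  by_contra! hbad
  have hM := h.pos.ne'
  have hcoset : ∀ {a b : ℝ}, (a : ℝ ⧸ Γ) = b → ∃ γ ∈ Γ, b = a + γ := by
    intro a b hab
    exact ⟨-a + b, QuotientAddGroup.eq.1 hab, by ring⟩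
  set rep : ℝ ⧸ Γ → ℝ := Quotient.out with hrep
  have hmk : ∀ q : ℝ ⧸ Γ, ((rep q : ℝ) : ℝ ⧸ Γ) = q := fun q => Quotient.out_eq' q
  have hWP : ∀ a : ℝ, w (rep a) = w a ∧ p (rep a) = p a := by
    intro a
    obtain ⟨γ, hγ, he⟩ := hcoset (hmk (a : ℝ ⧸ Γ))
    exact ⟨((congrArg w he).trans (h.w_add _ _ hγ)).symm, ((congrArg p he).trans (h.p_add _ _ hγ)).symm⟩
  -- The bad cosets. They form a finite set, since `1 ∈ Γ` puts a zero of `φ` from `[0, 1]` on each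
  -- of them, and it is closed under transitions of nonzero weight.
  set Y : Set (ℝ ⧸ Γ) := {q | w (rep q) ≠ 0 ∧ ∀ z ∈ Γ, φ (rep q + z) = 0} with hY
  have hmemY : ∀ a : ℝ, (a : ℝ ⧸ Γ) ∈ Y ↔ w a ≠ 0 ∧ ∀ z ∈ Γ, φ (a + z) = 0 := by
    intro a
    obtain ⟨γ, hγ, he⟩ := hcoset (hmk (a : ℝ ⧸ Γ))
    rw [hY, Set.mem_ofPred_eq, (hWP a).1]
    refine and_congr Iff.rfl ⟨fun H z hz => ?_, fun H z hz => ?_⟩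
    · rw [he, add_assoc]
      exact H _ (Γ.add_mem hγ hz)
    · have : rep (a : ℝ ⧸ Γ) + z = a + (z - γ) := by
        conv_rhs => rw [he]
        ring
      rw [this]
      exact H _ (Γ.sub_mem hz hγ)
  have hYfin : Y.Finite := by
    refine (hfin.image fun a : ℝ => (a : ℝ ⧸ Γ)).subset fun q hq => ?_
    have hfl : (⌊rep q⌋ : ℝ) ∈ Γ := by simpa using Γ.zsmul_mem h.one_mem ⌊rep q⌋
    refine ⟨Int.fract (rep q), ⟨⟨Int.fract_nonneg _, (Int.fract_lt_one _).le⟩, ?_⟩, ?_⟩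
    · have := hq.2 (-(⌊rep q⌋ : ℝ)) (Γ.neg_mem hfl)
      rwa [← sub_eq_add_neg, Int.self_sub_floor] at this
    · conv_rhs => rw [← hmk q]
      refine QuotientAddGroup.eq.2 ?_
      have : -Int.fract (rep q) + rep q = ⌊rep q⌋ := by
        rw [← Int.self_sub_floor]
        ring
      rwa [this]
  set S : Finset (ℝ ⧸ Γ) := hYfin.toFinset with hS
  have hSY : ∀ q, q ∈ S ↔ q ∈ Y := fun q => hYfin.mem_toFinset
  set f : (ℝ ⧸ Γ) × κ → ℝ ⧸ Γ := fun x => (((rep x.1 + l x.2) / M : ℝ) : ℝ ⧸ Γ) with hf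
  have hnext : ∀ (a : ℝ) (k : κ), (a : ℝ ⧸ Γ) ∈ Y →
      p ((a + l k) / M) * w ((a + l k) / M) ≠ 0 → (((a + l k) / M : ℝ) : ℝ ⧸ Γ) ∈ Y := by
    intro a k ha hne
    refine (hmemY _).2 ⟨right_ne_zero_of_mul hne, fun z hz => ?_⟩
    have h1 := ((hmemY a).1 ha).2 (l k + M * z) (Γ.add_mem (h.digit_mem k) (h.mul_mem z hz))
    have h2 : a + (l k + M * z) = M * ((a + l k) / M + z) := by
      field_simp
      ring
    rw [h2, h.φ_mul, h.p_add _ _ hz] at h1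
    exact (mul_eq_zero.1 h1).resolve_left (left_ne_zero_of_mul hne)
  have hinj : Set.InjOn f (S ×ˢ (univ : Finset κ) : Finset _) := by
    rintro ⟨q, k⟩ _ ⟨q', k'⟩ _ hqq
    obtain ⟨γ, hγ, he⟩ := hcoset hqq
    simp only at he
    have h1 : rep q' = rep q + (l k - l k' + M * γ) := by
      field_simp at he
      linarith
    have h2 : q = q' := by
      rw [← hmk q, ← hmk q', h1]
      refine QuotientAddGroup.eq.2 ?_
      rw [neg_add_cancel_left]
      exact Γ.add_mem (Γ.sub_mem (h.digit_mem k) (h.digit_mem k')) (h.mul_mem γ hγ)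
    subst h2
    have h3 : k' = k := by
      refine h.digit_injective ?_
      have : (l k' - l k) / M = γ := by
        field_simp
        linarith
      rwa [this]
    rw [h3]
  -- Harmonicity is summed over the bad cosets; the preimages are distinct modulo `Γ`, and those
  -- with nonzero weight are bad again. As `p ≤ 1`, equality follows, so `p = 1` on every bad coset.
  have hle : ∑ q ∈ S, w (rep q) ≤ ∑ q ∈ S, p (rep q) * w (rep q) := by
    calc ∑ q ∈ S, w (rep q)
        = ∑ x ∈ S ×ˢ (univ : Finset κ), p (rep (f x)) * w (rep (f x)) := by
          rw [sum_product]
          refine sum_congr rfl fun q _ => ?_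
          rw [← h.harmonic (rep q)]
          exact sum_congr rfl fun k _ => by rw [(hWP _).1, (hWP _).2]
      _ = ∑ q ∈ (S ×ˢ (univ : Finset κ)).image f, p (rep q) * w (rep q) :=
          (sum_image (f := fun q => p (rep q) * w (rep q)) hinj).symm
      _ = ∑ q ∈ ((S ×ˢ (univ : Finset κ)).image f).filter
            (fun q => p (rep q) * w (rep q) ≠ 0), p (rep q) * w (rep q) :=
          (sum_filter_ne_zero _).symm
      _ ≤ ∑ q ∈ S, p (rep q) * w (rep q) := by
          refine sum_le_sum_of_subset_of_nonneg (fun q hq => ?_) fun q _ _ =>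
            mul_nonneg (h.p_nonneg _) (h.w_nonneg _)
          obtain ⟨hq1, hq2⟩ := mem_filter.1 hq
          obtain ⟨⟨q', k⟩, hx, rfl⟩ := mem_image.1 hq1
          rw [(hWP _).1, (hWP _).2] at hq2
          refine (hSY _).2 (hnext _ _ ?_ hq2)
          rw [hmk]
          exact (hSY _).1 (mem_product.1 hx).1
  have hterm : ∀ q ∈ S, p (rep q) * w (rep q) ≤ w (rep q) := fun q _ =>
    mul_le_of_le_one_left (h.w_nonneg _) (h.p_le_one _)
  have heq := (sum_eq_sum_iff_of_le hterm).1 (le_antisymm (sum_le_sum hterm) hle)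
  have hone : ∀ a : ℝ, (a : ℝ ⧸ Γ) ∈ Y → p a = 1 := by
    intro a ha
    have := heq _ ((hSY _).2 ha)
    rw [(hWP a).1, (hWP a).2] at this
    exact mul_eq_right₀ ((hmemY a).1 ha).1 |>.1 this
  have hyY : (y : ℝ ⧸ Γ) ∈ Y := (hmemY y).2 ⟨hy, hbad⟩
  -- A bad `y` has a bad preimage `η`, so `p η = p (M * η) = 1`. Rigidity gives `y ∈ Γ`, and then `φ
  -- 0 = 1` contradicts badness.
  obtain ⟨k, -, hk⟩ : ∃ k ∈ (univ : Finset κ), p ((y + l k) / M) * w ((y + l k) / M) ≠ 0 :=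
    exists_ne_zero_of_sum_ne_zero (by rwa [h.harmonic y])
  have h1 := hrig _ (hone _ (hnext y k hyY hk)) (by
    rw [mul_div_cancel₀ _ hM, h.p_add _ _ (h.digit_mem k)]
    exact hone y hyY)
  rw [mul_div_cancel₀ _ hM] at h1
  have h2 : -y ∈ Γ := by
    have := Γ.sub_mem (h.digit_mem k) h1
    rwa [sub_add_cancel_right] at this
  have h3 := hbad (-y) h2
  rw [add_neg_cancel, h.φ_zero] at h3
  exact one_ne_zero h3

end IsHarmonicSystem

/-! ### Exponentials in `L²` and spectral measures -/

theorem norm_exp_two_pi_mul (a x : ℝ) :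
    ‖Complex.exp (2 * Real.pi * Complex.I * a * x)‖ = 1 := by
  have : (2 * Real.pi * Complex.I * a * x : ℂ) = ((2 * Real.pi * a * x : ℝ) : ℂ) * Complex.I := by
    push_cast
    ring
  rw [this, Complex.norm_exp_ofReal_mul_I]

theorem memLp_exponential (μ : Measure ℝ) [IsFiniteMeasure μ] (a : ℝ) :
    MemLp (fun x : ℝ => Complex.exp (2 * Real.pi * Complex.I * a * x)) 2 μ :=
  MemLp.of_bound (by fun_prop) 1 (Eventually.of_forall fun x => (norm_exp_two_pi_mul a x).le)

/-- The exponential `x ↦ e^{2πiax}` as an element of `L²(μ)`. -/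
def exponentialLp (μ : Measure ℝ) [IsFiniteMeasure μ] (a : ℝ) : Lp ℂ 2 μ :=
  (memLp_exponential μ a).toLp

theorem coeFn_exponentialLp (μ : Measure ℝ) [IsFiniteMeasure μ] (a : ℝ) :
    (exponentialLp μ a : ℝ → ℂ) =ᵐ[μ]
      fun x : ℝ => Complex.exp (2 * Real.pi * Complex.I * a * x) :=
  MemLp.coeFn_toLp _

theorem inner_exponentialLp_left (μ : Measure ℝ) [IsFiniteMeasure μ] (a : ℝ) (f : Lp ℂ 2 μ) :
    inner ℂ (exponentialLp μ a) f =
      ∫ x : ℝ, Complex.exp (((-(2 * Real.pi * a) : ℝ) : ℂ) * x * Complex.I) * f x ∂μ := by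
  rw [L2.inner_def]
  refine integral_congr_ae ?_
  filter_upwards [coeFn_exponentialLp μ a] with x hx
  rw [hx, RCLike.inner_apply, mul_comm, ← Complex.exp_conj]
  congr 2
  simp only [map_mul, map_ofNat, Complex.conj_ofReal, Complex.conj_I]
  push_cast
  ring

theorem inner_exponentialLp (μ : Measure ℝ) [IsFiniteMeasure μ] (a b : ℝ) :
    inner ℂ (exponentialLp μ a) (exponentialLp μ b) = charFun μ (2 * Real.pi * (b - a)) := by
  rw [inner_exponentialLp_left, charFun_apply_real]
  refine integral_congr_ae ?_
  filter_upwards [coeFn_exponentialLp μ b] with x hx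
  rw [hx, ← Complex.exp_add]
  congr 1
  push_cast
  ring

/-- A real integrable function is zero if all its Fourier coefficients vanish. -/
theorem ae_eq_zero_of_integral_exp_mul_ofReal {μ : Measure ℝ} [IsFiniteMeasure μ] {u : ℝ → ℝ}
    (hu : Integrable u μ)
    (h : ∀ t : ℝ, ∫ x : ℝ, Complex.exp (t * x * Complex.I) * (u x : ℂ) ∂μ = 0) : u =ᵐ[μ] 0 := by
  have hfin : ∀ v : ℝ → ℝ, Integrable v μ → ∫⁻ x, ENNReal.ofReal (v x) ∂μ ≠ ⊤ := fun v hv =>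
    (hv.lintegral_lt_top).ne
  have hfinm : ∀ v : ℝ → ℝ, Integrable v μ →
      IsFiniteMeasure (μ.withDensity fun x => ENNReal.ofReal (v x)) := fun v hv =>
    isFiniteMeasure_withDensity (hfin v hv)
  have hmeas : ∀ v : ℝ → ℝ, Integrable v μ → AEMeasurable (fun x => ENNReal.ofReal (v x)) μ :=
    fun v hv => hv.aemeasurable.ennreal_ofReal
  have hchar : ∀ v : ℝ → ℝ, Integrable v μ → ∀ t : ℝ,
      charFun (μ.withDensity fun x => ENNReal.ofReal (v x)) t =
        ∫ x : ℝ, Complex.exp (t * x * Complex.I) * ((max (v x) 0 : ℝ) : ℂ) ∂μ := by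
    intro v hv t
    rw [charFun_apply_real, integral_withDensity_eq_integral_toReal_smul₀ (hmeas v hv)
      (Eventually.of_forall fun _ => ENNReal.ofReal_lt_top)]
    refine integral_congr_ae (Eventually.of_forall fun x => ?_)
    simp only [ENNReal.toReal_ofReal', Complex.real_smul]
    rw [mul_comm]
  have hint : ∀ v : ℝ → ℝ, Integrable v μ → ∀ t : ℝ,
      Integrable (fun x : ℝ => Complex.exp (t * x * Complex.I) * ((max (v x) 0 : ℝ) : ℂ)) μ := by
    intro v hv t
    have h1 : Integrable (fun x => ((max (v x) 0 : ℝ) : ℂ)) μ := hv.pos_part.ofReal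
    refine h1.bdd_mul (c := 1) (by fun_prop) (Eventually.of_forall fun x => ?_)
    rw [← Complex.ofReal_mul, Complex.norm_exp_ofReal_mul_I]
  have hneg : Integrable (fun x => -u x) μ := hu.neg
  -- The positive and negative parts of `u` define finite measures with the same characteristic
  -- function.
  have heq : (μ.withDensity fun x => ENNReal.ofReal (u x)) =
      μ.withDensity fun x => ENNReal.ofReal (-u x) := by
    have := hfinm u hu
    have := hfinm _ hneg
    refine Measure.ext_of_charFun (funext fun t => sub_eq_zero.1 ?_)
    rw [hchar u hu, hchar _ hneg, ← integral_sub (hint u hu t) (hint _ hneg t), ← h t]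
    refine integral_congr_ae (Eventually.of_forall fun x => ?_)
    simp only
    rw [← mul_sub, ← Complex.ofReal_sub]
    congr 2
    rcases le_total (u x) 0 with hx | hx
    · rw [max_eq_right hx, max_eq_left (neg_nonneg.2 hx)]
      ring
    · rw [max_eq_left hx, max_eq_right (neg_nonpos.2 hx)]
      ring
  have hae := (withDensity_eq_iff (hmeas u hu) (hmeas _ hneg) (hfin u hu)).1 heq
  filter_upwards [hae] with x hx
  rcases le_total (u x) 0 with h0 | h0
  · rw [ENNReal.ofReal_of_nonpos h0, eq_comm, ENNReal.ofReal_eq_zero] at hx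
    exact le_antisymm h0 (neg_nonpos.1 hx)
  · rw [ENNReal.ofReal_of_nonpos (neg_nonpos.2 h0), ENNReal.ofReal_eq_zero] at hx
    exact le_antisymm hx h0

/-- A complex integrable function is zero if all its Fourier coefficients vanish. -/
theorem ae_eq_zero_of_integral_exp_mul {μ : Measure ℝ} [IsFiniteMeasure μ] {f : ℝ → ℂ}
    (hf : Integrable f μ)
    (h : ∀ t : ℝ, ∫ x : ℝ, Complex.exp (t * x * Complex.I) * f x ∂μ = 0) : f =ᵐ[μ] 0 := by
  have hint : ∀ g : ℝ → ℂ, Integrable g μ → ∀ t : ℝ,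
      Integrable (fun x : ℝ => Complex.exp (t * x * Complex.I) * g x) μ := by
    intro g hg t
    refine hg.bdd_mul (c := 1) (by fun_prop) (Eventually.of_forall fun x => ?_)
    rw [← Complex.ofReal_mul, Complex.norm_exp_ofReal_mul_I]
  have hconj : Integrable (fun x => (starRingEnd ℂ) (f x)) μ :=
    (Complex.conjLIE.integrable_comp_iff).2 hf
  -- The hypothesis at `-t`, conjugated, handles `conj f`, and with it the real and imaginary parts.
  have h' : ∀ t : ℝ, ∫ x : ℝ, Complex.exp (t * x * Complex.I) * (starRingEnd ℂ) (f x) ∂μ = 0 := by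
    intro t
    have h1 := congrArg (starRingEnd ℂ) (h (-t))
    rw [map_zero, ← integral_conj] at h1
    rw [← h1]
    refine integral_congr_ae (Eventually.of_forall fun x => ?_)
    simp only [map_mul, ← Complex.exp_conj]
    congr 2
    simp
  have hre : (fun x => (f x).re) =ᵐ[μ] 0 := by
    refine ae_eq_zero_of_integral_exp_mul_ofReal hf.re fun t => ?_
    have h1 : ∀ x : ℝ, Complex.exp (t * x * Complex.I) * ((f x).re : ℂ) =
        (1 / 2 : ℂ) * (Complex.exp (t * x * Complex.I) * f x +
          Complex.exp (t * x * Complex.I) * (starRingEnd ℂ) (f x)) := by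
      intro x
      rw [Complex.re_eq_add_conj]
      ring
    simp_rw [h1]
    rw [integral_const_mul, integral_add (hint _ hf t) (hint _ hconj t), h t, h' t]
    simp
  have him : (fun x => (f x).im) =ᵐ[μ] 0 := by
    refine ae_eq_zero_of_integral_exp_mul_ofReal hf.im fun t => ?_
    have h1 : ∀ x : ℝ, Complex.exp (t * x * Complex.I) * ((f x).im : ℂ) =
        (1 / (2 * Complex.I) : ℂ) * (Complex.exp (t * x * Complex.I) * f x -
          Complex.exp (t * x * Complex.I) * (starRingEnd ℂ) (f x)) := by
      intro x
      rw [Complex.im_eq_sub_conj]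
      ring
    simp_rw [h1]
    rw [integral_const_mul, integral_sub (hint _ hf t) (hint _ hconj t), h t, h' t]
    simp
  filter_upwards [hre, him] with x h1 h2
  exact Complex.ext h1 h2

theorem eq_zero_of_inner_exponentialLp {μ : Measure ℝ} [IsFiniteMeasure μ] {f : Lp ℂ 2 μ}
    (h : ∀ a : ℝ, inner ℂ (exponentialLp μ a) f = 0) : f = 0 := by
  have hf : Integrable f μ := (Lp.memLp f).integrable (by norm_num)
  rw [Lp.eq_zero_iff_ae_eq_zero]
  refine ae_eq_zero_of_integral_exp_mul hf fun t => ?_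
  have h1 := h (-(t / (2 * Real.pi)))
  rw [inner_exponentialLp_left] at h1
  have h2 : -(2 * Real.pi * -(t / (2 * Real.pi))) = t := by
    have := Real.pi_ne_zero
    field_simp
  rwa [h2] at h1

/-- A vector orthogonal to an orthonormal family is orthogonal to every vector for which
Parseval's identity holds. -/
theorem inner_eq_zero_of_hasSum_norm_sq_inner {E ι : Type*} [NormedAddCommGroup E]
    [InnerProductSpace ℂ E] {v : ι → E} (hv : Orthonormal ℂ v) {e f : E}
    (hf : ∀ i, inner ℂ (v i) f = 0) (he : HasSum (fun i => ‖inner ℂ (v i) e‖ ^ 2) (‖e‖ ^ 2)) :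
    inner ℂ e f = 0 := by
  have hle : ∀ s : Finset ι, ‖inner ℂ e f‖ ^ 2 ≤
      (‖e‖ ^ 2 - ∑ i ∈ s, ‖inner ℂ (v i) e‖ ^ 2) * ‖f‖ ^ 2 := by
    intro s
    set c : ι → ℂ := fun i => inner ℂ (v i) e
    set g : E := ∑ i ∈ s, c i • v i with hg
    -- `f` is orthogonal to the projection `g` of `e`, so Cauchy–Schwarz leaves only the Parseval
    -- defect of `e`.
    have h1 : inner ℂ e f = inner ℂ (e - g) f := by
      rw [inner_sub_left, hg, sum_inner]
      simp [inner_smul_left, hf]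
    have h2 : ‖e - g‖ ^ 2 = ‖e‖ ^ 2 - ∑ i ∈ s, ‖c i‖ ^ 2 := by
      have h3 : inner ℂ e g = ((∑ i ∈ s, ‖c i‖ ^ 2 : ℝ) : ℂ) := by
        rw [hg, inner_sum]
        push_cast
        refine sum_congr rfl fun i _ => ?_
        rw [inner_smul_right, ← inner_conj_symm, Complex.mul_conj, Complex.normSq_eq_norm_sq]
        push_cast
        rfl
      have h4 : ‖g‖ ^ 2 = ∑ i ∈ s, ‖c i‖ ^ 2 := by
        have h5 : inner ℂ g g = ((∑ i ∈ s, ‖c i‖ ^ 2 : ℝ) : ℂ) := by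
          rw [hg, hv.inner_sum]
          push_cast
          exact sum_congr rfl fun i _ => Complex.conj_mul' _
        rw [@norm_sq_eq_re_inner ℂ, h5]
        exact Complex.ofReal_re _
      rw [@norm_sub_sq ℂ, h3, h4]
      have : RCLike.re ((∑ i ∈ s, ‖c i‖ ^ 2 : ℝ) : ℂ) = ∑ i ∈ s, ‖c i‖ ^ 2 :=
        Complex.ofReal_re _
      rw [this]
      ring
    rw [h1, ← h2, ← mul_pow]
    exact pow_le_pow_left₀ (norm_nonneg _) (norm_inner_le_norm _ _) 2
  have hlim : Tendsto (fun s : Finset ι =>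
      (‖e‖ ^ 2 - ∑ i ∈ s, ‖inner ℂ (v i) e‖ ^ 2) * ‖f‖ ^ 2) atTop (𝓝 0) := by
    have := (tendsto_const_nhds (x := ‖e‖ ^ 2)).sub he |>.mul_const (‖f‖ ^ 2)
    rwa [sub_self, zero_mul] at this
  have := ge_of_tendsto' hlim hle
  exact norm_eq_zero.1 (pow_eq_zero_iff two_ne_zero |>.1 (le_antisymm this (by positivity)))

/-- The criterion of Jorgensen and Pedersen: `Λ` is a spectrum of `μ` as soon as
`∑_{λ ∈ Λ} |μ̂(ξ + λ)|² = 1` for all `ξ`. -/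
theorem isSpectralMeasure_of_hasSum {μ : Measure ℝ} [IsProbabilityMeasure μ] {Λ : Set ℝ}
    (hΛ : Λ.Countable)
    (h : ∀ ξ : ℝ, HasSum (fun x : Λ => ‖charFun μ (2 * Real.pi * (ξ + x))‖ ^ 2) 1) :
    IsSpectralMeasure μ := by
  classical
  have hnorm : ∀ a : ℝ, ‖exponentialLp μ a‖ ^ 2 = 1 := by
    intro a
    rw [@norm_sq_eq_re_inner ℂ, inner_exponentialLp, sub_self, mul_zero, charFun_zero]
    simp
  have horth : Orthonormal ℂ fun x : Λ => exponentialLp μ (x : ℝ) := by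
    refine ⟨fun x => ?_, fun x y hxy => ?_⟩
    · exact (pow_eq_one_iff_of_nonneg (norm_nonneg _) two_ne_zero).1 (hnorm x)
    -- At `ξ = -x` the term of `x` already equals the total `1`, so the term of `y` vanishes.
    · have h1 := sum_le_hasSum {x, y} (fun _ _ => by positivity) (h (-x))
      rw [sum_pair hxy, neg_add_cancel, mul_zero, charFun_zero] at h1
      simp only [probReal_univ, Complex.ofReal_one, norm_one, one_pow,
        add_le_iff_nonpos_right] at h1
      have h2 := pow_eq_zero_iff two_ne_zero |>.1 (le_antisymm h1 (by positivity))
      beta_reduce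
      rw [inner_exponentialLp, sub_eq_neg_add]
      exact norm_eq_zero.1 h2
  have hbot : (Submodule.span ℂ (Set.range fun x : Λ => exponentialLp μ (x : ℝ)))ᗮ = ⊥ := by
    rw [Submodule.eq_bot_iff]
    intro f hf
    have hf' : ∀ x : Λ, inner ℂ (exponentialLp μ (x : ℝ)) f = 0 := fun x =>
      Submodule.mem_orthogonal _ _ |>.1 hf _ (Submodule.subset_span ⟨x, rfl⟩)
    refine eq_zero_of_inner_exponentialLp fun a => ?_
    refine inner_eq_zero_of_hasSum_norm_sq_inner horth hf' ?_
    rw [hnorm]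
    convert h (-a) using 3 with x
    rw [norm_inner_symm, inner_exponentialLp, sub_eq_neg_add]
  refine ⟨inferInstance, Λ, hΛ, HilbertBasis.mkOfOrthogonalEqBot horth hbot, fun x => ?_⟩
  rw [HilbertBasis.coe_mkOfOrthogonalEqBot]
  exact coeFn_exponentialLp μ x

/-! ### Masks -/

/-- `e^{2πit}`. -/
def unitExp (t : ℝ) : ℂ := Complex.exp (((2 * Real.pi * t : ℝ) : ℂ) * Complex.I)

theorem norm_unitExp (t : ℝ) : ‖unitExp t‖ = 1 := Complex.norm_exp_ofReal_mul_I _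

theorem unitExp_zero : unitExp 0 = 1 := by simp [unitExp]

theorem unitExp_add (s t : ℝ) : unitExp (s + t) = unitExp s * unitExp t := by
  rw [unitExp, unitExp, unitExp, ← Complex.exp_add]
  congr 1
  push_cast
  ring

theorem unitExp_eq_one_iff {t : ℝ} : unitExp t = 1 ↔ ∃ n : ℤ, t = n := by
  rw [unitExp, Complex.exp_eq_one_iff]
  refine exists_congr fun n => ?_
  have h : ((2 * Real.pi * t : ℝ) : ℂ) * Complex.I = (t : ℂ) * (2 * Real.pi * Complex.I) := by
    push_cast
    ring
  rw [h, mul_left_inj' Complex.two_pi_I_ne_zero]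
  norm_cast

theorem conj_unitExp (t : ℝ) : (starRingEnd ℂ) (unitExp t) = unitExp (-t) := by
  rw [unitExp, unitExp, ← Complex.exp_conj]
  congr 1
  simp only [map_mul, Complex.conj_ofReal, Complex.conj_I]
  push_cast
  ring

theorem continuous_unitExp : Continuous unitExp := by
  unfold unitExp
  fun_prop

theorem analyticOnNhd_unitExp_mul (a : ℝ) :
    AnalyticOnNhd ℝ (fun t => unitExp (a * t)) Set.univ := by
  intro t _
  have h1 : AnalyticAt ℝ (fun s : ℝ => ((2 * Real.pi * a * Complex.I : ℂ)) * (s : ℂ)) t :=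
    analyticAt_const.mul (Complex.ofRealCLM.analyticAt t)
  refine ((analyticAt_cexp.restrictScalars (𝕜 := ℝ)).comp h1).congr (Eventually.of_forall fun s => ?_)
  simp only [Function.comp_apply, unitExp]
  congr 1
  push_cast
  ring

/-- The weighted trigonometric sum `(#A)⁻¹ ∑_{a ∈ A} v a e^{2πiat}`. -/
def amplitude (A : Finset ℤ) (v : ℤ → ℂ) (t : ℝ) : ℂ :=
  (A.card : ℂ)⁻¹ * ∑ a ∈ A, v a * unitExp (a * t)

/-- The mask `(#D)⁻¹ ∑_{d ∈ D} e^{2πidt}`. -/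
def mask (D : Finset ℤ) (t : ℝ) : ℂ := amplitude D 1 t

theorem amplitude_add_int (A : Finset ℤ) (v : ℤ → ℂ) (t : ℝ) (n : ℤ) :
    amplitude A v (t + n) = amplitude A v t := by
  unfold amplitude
  congr 1
  refine sum_congr rfl fun a _ => ?_
  have h : unitExp (a * n) = 1 := unitExp_eq_one_iff.2 ⟨a * n, by push_cast; rfl⟩
  rw [mul_add, unitExp_add, h, mul_one]

theorem mask_add_int (A : Finset ℤ) (t : ℝ) (n : ℤ) : mask A (t + n) = mask A t :=
  amplitude_add_int A 1 t n

theorem mask_eq (D : Finset ℤ) (t : ℝ) :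
    mask D t = (D.card : ℂ)⁻¹ * ∑ d ∈ D, unitExp (d * t) := by
  simp [mask, amplitude]

theorem mask_zero {D : Finset ℤ} (hD : D.Nonempty) : mask D 0 = 1 := by
  rw [mask_eq]
  have : (D.card : ℂ) ≠ 0 := by simpa using hD.ne_empty
  simp [unitExp_zero, this]

theorem continuous_mask (D : Finset ℤ) : Continuous (mask D) := by
  have : mask D = fun t => (D.card : ℂ)⁻¹ * ∑ d ∈ D, unitExp (d * t) := funext (mask_eq D)
  rw [this]
  exact continuous_const.mul (continuous_finsetSum _ fun d _ =>
    continuous_unitExp.comp (continuous_const.mul continuous_id))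

theorem norm_mask_le_one (D : Finset ℤ) (t : ℝ) : ‖mask D t‖ ≤ 1 := by
  rw [mask_eq, norm_mul, norm_inv, Complex.norm_natCast]
  have : ‖∑ d ∈ D, unitExp (d * t)‖ ≤ D.card := by
    refine (norm_sum_le _ _).trans ?_
    simp [norm_unitExp]
  exact (mul_le_mul_of_nonneg_left this (by positivity)).trans inv_mul_le_one

/-- The group of all `t` such that `(d - d') t` is an integer for all `d, d' ∈ D`. -/
def differenceDual (D : Finset ℤ) : AddSubgroup ℝ where
  carrier := {t | ∀ d ∈ D, ∀ d' ∈ D, ∃ n : ℤ, ((d : ℝ) - d') * t = n}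
  zero_mem' := fun d _ d' _ => ⟨0, by simp⟩
  add_mem' := by
    intro s t hs ht d hd d' hd'
    obtain ⟨m, hm⟩ := hs d hd d' hd'
    obtain ⟨n, hn⟩ := ht d hd d' hd'
    exact ⟨m + n, by rw [mul_add, hm, hn]; push_cast; rfl⟩
  neg_mem' := by
    intro t ht d hd d' hd'
    obtain ⟨n, hn⟩ := ht d hd d' hd'
    exact ⟨-n, by rw [mul_neg, hn]; push_cast; rfl⟩

theorem mem_differenceDual {D : Finset ℤ} {t : ℝ} :
    t ∈ differenceDual D ↔ ∀ d ∈ D, ∀ d' ∈ D, ∃ n : ℤ, ((d : ℝ) - d') * t = n := Iff.rfl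

theorem int_mem_differenceDual (D : Finset ℤ) (n : ℤ) : (n : ℝ) ∈ differenceDual D :=
  fun d _ d' _ => ⟨(d - d') * n, by push_cast; rfl⟩

theorem norm_mask_add {D : Finset ℤ} (t : ℝ) {γ : ℝ} (hγ : γ ∈ differenceDual D) :
    ‖mask D (t + γ)‖ = ‖mask D t‖ := by
  rcases D.eq_empty_or_nonempty with rfl | ⟨d₀, hd₀⟩
  · simp [mask_eq]
  have : mask D (t + γ) = unitExp (d₀ * γ) * mask D t := by
    rw [mask_eq, mask_eq, mul_left_comm]
    congr 1
    rw [mul_sum]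
    refine sum_congr rfl fun d hd => ?_
    have h1 : (d : ℝ) * (t + γ) = d₀ * γ + d * t + (d - d₀) * γ := by ring
    rw [h1, unitExp_add, unitExp_add, unitExp_eq_one_iff.2 (hγ d hd d₀ hd₀), mul_one]
  rw [this, norm_mul, norm_unitExp, one_mul]

/-- This is equality in the triangle inequality: the unit vectors have mean `u` with `‖u‖ = 1`, so
their variance about `u` is zero and they all equal `u`. -/
theorem mem_differenceDual_of_norm_mask_eq_one {D : Finset ℤ} {t : ℝ} (h : ‖mask D t‖ = 1) :
    t ∈ differenceDual D := by
  set u := mask D t with hu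
  have hD : (D.card : ℂ) ≠ 0 := by
    intro h0
    rw [hu, mask_eq, h0] at h
    simp at h
  have hsum : ∑ d ∈ D, unitExp (d * t) = D.card * u := by
    rw [hu, mask_eq, mul_inv_cancel_left₀ hD]
  have h1 : ∑ d ∈ D, ‖unitExp (d * t) - u‖ ^ 2 = 0 := by
    have h2 : ∀ d ∈ D, ‖unitExp (d * t) - u‖ ^ 2 =
        2 - 2 * (unitExp (d * t) * (starRingEnd ℂ) u).re := by
      intro d _
      rw [← Complex.normSq_eq_norm_sq, Complex.normSq_sub, Complex.normSq_eq_norm_sq,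
        Complex.normSq_eq_norm_sq, norm_unitExp, h]
      ring
    rw [sum_congr rfl h2, sum_sub_distrib, ← mul_sum, ← Complex.re_sum, ← sum_mul, hsum, mul_assoc,
      Complex.mul_conj, Complex.normSq_eq_norm_sq, h]
    simp
    ring
  have h3 : ∀ d ∈ D, unitExp (d * t) = u := by
    intro d hd
    have := (sum_eq_zero_iff_of_nonneg fun d _ => by positivity).1 h1 d hd
    exact sub_eq_zero.1 (norm_eq_zero.1 (pow_eq_zero_iff two_ne_zero |>.1 this))
  intro d hd d' hd'
  refine unitExp_eq_one_iff.1 ?_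
  have h4 : ((d : ℝ) - d') * t = d * t + -(d' * t) := by ring
  rw [h4, unitExp_add, ← conj_unitExp, h3 d hd, h3 d' hd', Complex.mul_conj,
    Complex.normSq_eq_norm_sq, h]
  simp

/-! ### Parseval identities of Hadamard triples -/

namespace IsHadamardTriple

variable {N : ℕ} {D L : Finset ℤ}

theorem sum_unitExp (h : IsHadamardTriple N D L) {d d' : ℤ} (hd : d ∈ D) (hd' : d' ∈ D) :
    ∑ l ∈ L, unitExp (((d : ℝ) - d') * (l / N)) = if d = d' then (D.card : ℂ) else 0 := by
  have hD : (0 : ℝ) < D.card := by exact_mod_cast h.nonempty.card_pos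
  have hD' : (D.card : ℂ) ≠ 0 := by exact_mod_cast hD.ne'
  have h1 := congrFun (congrFun h.mul_conjTranspose ⟨d, hd⟩) ⟨d', hd'⟩
  rw [Matrix.mul_apply, Matrix.one_apply] at h1
  have h2 : ∀ l : L, hadamardMatrix N D L ⟨d, hd⟩ l *
      (hadamardMatrix N D L).conjTranspose l ⟨d', hd'⟩ =
      (D.card : ℂ)⁻¹ * unitExp (((d : ℝ) - d') * ((l : ℤ) / N)) := by
    intro l
    have e : ∀ c : ℤ, Complex.exp (2 * Real.pi * Complex.I * ((c : ℂ) * ((l : ℤ) : ℂ) / (N : ℂ))) =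
        unitExp (c * ((l : ℤ) / N)) := by
      intro c
      rw [unitExp]
      congr 1
      push_cast
      ring
    have e2 : (1 / (Real.sqrt (D.card : ℝ) : ℂ)) * (1 / (Real.sqrt (D.card : ℝ) : ℂ)) =
        (D.card : ℂ)⁻¹ := by
      rw [div_mul_div_comm, one_mul, ← Complex.ofReal_mul, Real.mul_self_sqrt hD.le, one_div]
      simp
    rw [Matrix.conjTranspose_apply, hadamardMatrix, hadamardMatrix, e, e, star_mul', ← e2]
    have e3 : star (1 / (Real.sqrt (D.card : ℝ) : ℂ)) = 1 / (Real.sqrt (D.card : ℝ) : ℂ) := by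
      rw [← Complex.ofReal_one, ← Complex.ofReal_div]
      exact Complex.conj_ofReal _
    have e4 : star (unitExp (d' * ((l : ℤ) / N))) = unitExp (-(d' * ((l : ℤ) / N))) :=
      conj_unitExp _
    have e5 : ((d : ℝ) - d') * ((l : ℤ) / N) = d * ((l : ℤ) / N) + -(d' * ((l : ℤ) / N)) := by
      ring
    rw [e3, e4, e5, unitExp_add]
    ring
  rw [sum_congr rfl fun l _ => h2 l, ← mul_sum] at h1
  rw [← Finset.sum_coe_sort L]
  rw [inv_mul_eq_iff_eq_mul₀ hD'] at h1
  rw [h1]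
  simp [Subtype.mk.injEq]

theorem card_eq (h : IsHadamardTriple N D L) : D.card = L.card := by
  have h1 := Matrix.trace_mul_comm (hadamardMatrix N D L) (hadamardMatrix N D L).conjTranspose
  rw [h.mul_conjTranspose, h.conjTranspose_mul, Matrix.trace_one, Matrix.trace_one] at h1
  simpa using h1

/-- Congruent digits give equal rows of the matrix, which cannot be orthogonal. -/
theorem eq_of_dvd_sub (h : IsHadamardTriple N D L) {d d' : ℤ} (hd : d ∈ D) (hd' : d' ∈ D)
    (hdvd : (N : ℤ) ∣ d - d') : d = d' := by
  by_contra hne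
  have h1 := h.sum_unitExp hd hd'
  rw [if_neg hne] at h1
  have h2 : ∀ l ∈ L, unitExp (((d : ℝ) - d') * (l / N)) = 1 := by
    intro l _
    rw [unitExp_eq_one_iff]
    obtain ⟨c, hc⟩ := hdvd
    have hc' : ((d : ℝ) - d') = N * c := by exact_mod_cast hc
    rcases eq_or_ne (N : ℝ) 0 with h0 | h0
    · exact ⟨0, by simp [h0]⟩
    · exact ⟨c * l, by rw [hc']; push_cast; field_simp⟩
  rw [sum_congr rfl h2, sum_const, nsmul_eq_mul, mul_one, ← h.card_eq] at h1
  exact h.nonempty.card_pos.ne' (by exact_mod_cast h1)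

/-- Parseval's identity for a Hadamard triple. -/
theorem sum_norm_sq (h : IsHadamardTriple N D L) {ι : Type*} {s : Finset ι} {f : ι → ℤ}
    (hf : Set.InjOn f s) (hs : ∀ i ∈ s, f i ∈ D) (v : ι → ℂ) (y : ℝ) :
    ∑ l ∈ L, ‖∑ i ∈ s, v i * unitExp (f i * ((y + l) / N))‖ ^ 2 =
      D.card * ∑ i ∈ s, ‖v i‖ ^ 2 := by
  classical
  have hsq : ∀ z : ℂ, ((‖z‖ ^ 2 : ℝ) : ℂ) = z * (starRingEnd ℂ) z := fun z => by
    rw [Complex.mul_conj, Complex.normSq_eq_norm_sq]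
  apply Complex.ofReal_injective
  rw [Complex.ofReal_sum, Complex.ofReal_mul, Complex.ofReal_sum, Complex.ofReal_natCast]
  simp_rw [hsq, map_sum, sum_mul_sum, map_mul, conj_unitExp]
  rw [sum_comm, mul_sum]
  refine sum_congr rfl fun i hi => ?_
  rw [sum_comm]
  have h1 : ∀ j ∈ s, ∑ l ∈ L, v i * unitExp (f i * ((y + l) / N)) *
      ((starRingEnd ℂ) (v j) * unitExp (-(f j * ((y + l) / N)))) =
      if i = j then (D.card : ℂ) * (v i * (starRingEnd ℂ) (v j)) else 0 := by
    intro j hj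
    have h2 : ∀ l ∈ L, v i * unitExp (f i * ((y + l) / N)) *
        ((starRingEnd ℂ) (v j) * unitExp (-(f j * ((y + l) / N)))) =
        v i * (starRingEnd ℂ) (v j) * unitExp (((f i : ℝ) - f j) * (y / N)) *
          unitExp (((f i : ℝ) - f j) * (l / N)) := by
      intro l _
      have h3 : ((f i : ℝ) - f j) * (y / N) + ((f i : ℝ) - f j) * (l / N) =
          f i * ((y + l) / N) + -(f j * ((y + l) / N)) := by ring
      rw [mul_assoc _ (unitExp _) (unitExp _), ← unitExp_add, h3, unitExp_add]
      ring
    rw [sum_congr rfl h2, ← mul_sum, h.sum_unitExp (hs i hi) (hs j hj)]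
    by_cases hij : i = j
    · subst hij
      simp [unitExp_zero]
      ring
    · rw [if_neg hij, if_neg fun e => hij (hf hi hj e), mul_zero]
  rw [sum_congr rfl h1, sum_ite_eq, if_pos hi]

theorem sum_norm_sq_amplitude (h : IsHadamardTriple N D L) (v : ℤ → ℂ) (y : ℝ) :
    ∑ l ∈ L, ‖amplitude D v ((y + l) / N)‖ ^ 2 = (D.card : ℝ)⁻¹ * ∑ a ∈ D, ‖v a‖ ^ 2 := by
  have hD : (D.card : ℝ) ≠ 0 := by exact_mod_cast h.nonempty.card_pos.ne'
  have h1 := h.sum_norm_sq (f := id) (s := D) Function.injective_id.injOn (fun i hi => hi) v y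
  simp only [amplitude, norm_mul, mul_pow, norm_inv, Complex.norm_natCast, ← mul_sum]
  simp only [id] at h1
  rw [h1]
  field_simp

theorem sum_norm_sq_mask (h : IsHadamardTriple N D L) (y : ℝ) :
    ∑ l ∈ L, ‖mask D ((y + l) / N)‖ ^ 2 = 1 := by
  have hD : (D.card : ℝ) ≠ 0 := by exact_mod_cast h.nonempty.card_pos.ne'
  have := h.sum_norm_sq_amplitude 1 y
  simpa [mask, hD] using this

end IsHadamardTriple

/-! ### The harmonic weight and its sums over preimages -/

/-- The mean of `|mask (B a)|²` over `a ∈ A`. -/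
def meanMask (A : Finset ℤ) (B : ℤ → Finset ℤ) (t : ℝ) : ℝ :=
  (A.card : ℝ)⁻¹ * ∑ a ∈ A, ‖mask (B a) t‖ ^ 2

theorem meanMask_nonneg (A : Finset ℤ) (B : ℤ → Finset ℤ) (t : ℝ) : 0 ≤ meanMask A B t := by
  unfold meanMask
  positivity

theorem meanMask_le_one (A : Finset ℤ) (B : ℤ → Finset ℤ) (t : ℝ) : meanMask A B t ≤ 1 := by
  unfold meanMask
  have : ∑ a ∈ A, ‖mask (B a) t‖ ^ 2 ≤ A.card := by
    refine (sum_le_sum fun a _ => pow_le_one₀ (norm_nonneg _) (norm_mask_le_one _ _)).trans ?_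
    simp
  exact (mul_le_mul_of_nonneg_left this (by positivity)).trans inv_mul_le_one

theorem continuous_meanMask (A : Finset ℤ) (B : ℤ → Finset ℤ) : Continuous (meanMask A B) :=
  continuous_const.mul (continuous_finsetSum _ fun _ _ => ((continuous_mask _).norm.pow 2))

theorem meanMask_zero {A : Finset ℤ} {B : ℤ → Finset ℤ} (hA : A.Nonempty)
    (hB : ∀ a ∈ A, (B a).Nonempty) : meanMask A B 0 = 1 := by
  have h1 : ∀ a ∈ A, ‖mask (B a) 0‖ ^ 2 = 1 := fun a ha => by simp [mask_zero (hB a ha)]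
  have : (A.card : ℝ) ≠ 0 := by exact_mod_cast hA.card_pos.ne'
  rw [meanMask, sum_congr rfl h1]
  simp [this]

theorem sum_meanMask {N : ℕ} {A L : Finset ℤ} {B : ℤ → Finset ℤ} (hA : A.Nonempty)
    (hB : ∀ a ∈ A, IsHadamardTriple N (B a) L) (y : ℝ) :
    ∑ l ∈ L, meanMask A B ((y + l) / N) = 1 := by
  have hA' : (A.card : ℝ) ≠ 0 := by exact_mod_cast hA.card_pos.ne'
  simp only [meanMask, ← mul_sum]
  rw [sum_comm, sum_congr rfl fun a ha => (hB a ha).sum_norm_sq_mask y]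
  simp [hA']

theorem IsDirectSum.injOn {A B : Finset ℤ} (h : IsDirectSum A B) :
    Set.InjOn (fun x : ℤ × ℤ => x.1 + x.2) (A ×ˢ B : Finset (ℤ × ℤ)) := by
  rw [coe_product]
  exact Finset.card_add_iff.1 h

theorem IsDirectSum.sum_eq {A B : Finset ℤ} (h : IsDirectSum A B) (f : ℤ → ℝ) :
    ∑ c ∈ A + B, f c = ∑ a ∈ A, ∑ b ∈ B, f (a + b) := by
  rw [← sum_product', ← sum_image (f := f) (g := fun x : ℤ × ℤ => x.1 + x.2) h.injOn]
  rfl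

/-- For each fixed `l₂`, the sum over `L₁` is Parseval for `A` at `y + l₂`, with a value independent
of `l₂`. -/
theorem sum_norm_sq_amplitude_add {N : ℕ} {A L₁ L₂ : Finset ℤ} (hL : IsDirectSum L₁ L₂)
    (hA : IsHadamardTriple N A L₁) (v : ℤ → ℂ) (y : ℝ) :
    ∑ l ∈ L₁ + L₂, ‖amplitude A v ((y + l) / N)‖ ^ 2 =
      L₂.card * ((A.card : ℝ)⁻¹ * ∑ a ∈ A, ‖v a‖ ^ 2) := by
  rw [hL.sum_eq fun l : ℤ => ‖amplitude A v ((y + l) / N)‖ ^ 2, sum_comm]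
  have h1 : ∀ l₂ ∈ L₂, ∑ l₁ ∈ L₁, ‖amplitude A v ((y + ((l₁ + l₂ : ℤ) : ℝ)) / N)‖ ^ 2 =
      (A.card : ℝ)⁻¹ * ∑ a ∈ A, ‖v a‖ ^ 2 := by
    intro l₂ _
    rw [← hA.sum_norm_sq_amplitude v (y + l₂)]
    refine sum_congr rfl fun l₁ _ => ?_
    push_cast
    rw [add_comm (l₁ : ℝ), add_assoc]
  rw [sum_congr rfl h1, sum_const, nsmul_eq_mul]

/-- The product of the amplitude with the mask of `B a'` is a trigonometric sum over `A ⊕ B a'` with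
coefficient `v a` at `a + b`. Parseval gives the same value for every `a'`, which survives
averaging. -/
theorem sum_norm_sq_amplitude_mul_meanMask {N : ℕ} {A L : Finset ℤ} {B : ℤ → Finset ℤ}
    (hA : A.Nonempty) (hB : ∀ a ∈ A, IsDirectSum A (B a) ∧ IsHadamardTriple N (A + B a) L)
    (v : ℤ → ℂ) (y : ℝ) :
    ∑ l ∈ L, ‖amplitude A v ((y + l) / N)‖ ^ 2 * meanMask A B ((y + l) / N) =
      (A.card : ℝ)⁻¹ * ∑ a ∈ A, ‖v a‖ ^ 2 := by
  have hA' : (A.card : ℝ) ≠ 0 := by exact_mod_cast hA.card_pos.ne'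
  have key : ∀ a' ∈ A, ∑ l ∈ L, ‖amplitude A v ((y + l) / N)‖ ^ 2 *
      ‖mask (B a') ((y + l) / N)‖ ^ 2 = (A.card : ℝ)⁻¹ * ∑ a ∈ A, ‖v a‖ ^ 2 := by
    intro a' ha'
    obtain ⟨hdir, hhad⟩ := hB a' ha'
    have hBne : ((B a').card : ℝ) ≠ 0 := by
      have := hhad.nonempty.card_pos
      rw [hdir] at this
      exact_mod_cast (Nat.pos_of_mul_pos_left this).ne'
    have h1 := hhad.sum_norm_sq hdir.injOn (fun x hx => add_mem_add (mem_product.1 hx).1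
      (mem_product.1 hx).2) (fun x => v x.1) y
    have h2 : ∀ t : ℝ, ∑ x ∈ A ×ˢ B a', v x.1 * unitExp (((x.1 + x.2 : ℤ) : ℝ) * t) =
        (A.card * (B a').card : ℂ) * (amplitude A v t * mask (B a') t) := by
      intro t
      have hA'' : (A.card : ℂ) ≠ 0 := by exact_mod_cast hA'
      have hB'' : ((B a').card : ℂ) ≠ 0 := by exact_mod_cast hBne
      rw [amplitude, mask_eq]
      have : (A.card * (B a').card : ℂ) * ((A.card : ℂ)⁻¹ * ∑ a ∈ A, v a * unitExp (a * t) *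
          (((B a').card : ℂ)⁻¹ * ∑ d ∈ B a', unitExp (d * t))) =
          (∑ a ∈ A, v a * unitExp (a * t)) * ∑ d ∈ B a', unitExp (d * t) := by
        rw [← sum_mul]
        generalize ∑ a ∈ A, v a * unitExp (a * t) = X
        generalize ∑ d ∈ B a', unitExp (d * t) = Z
        field_simp
      rw [mul_assoc (A.card : ℂ)⁻¹, sum_mul, this, sum_mul_sum, sum_product]
      refine sum_congr rfl fun a _ => sum_congr rfl fun b _ => ?_
      push_cast
      rw [add_mul, unitExp_add, mul_assoc]
    simp_rw [h2, norm_mul, mul_pow, Complex.norm_natCast] at h1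
    rw [← mul_sum, sum_product, hdir] at h1
    simp only [sum_const, nsmul_eq_mul, ← mul_sum] at h1
    push_cast at h1
    have h3 : ((A.card : ℝ) * (B a').card) ≠ 0 := mul_ne_zero hA' hBne
    field_simp at h1 ⊢
    linarith
  simp only [meanMask]
  have h4 : ∀ l ∈ L, ‖amplitude A v ((y + l) / N)‖ ^ 2 *
      ((A.card : ℝ)⁻¹ * ∑ a ∈ A, ‖mask (B a) ((y + l) / N)‖ ^ 2) =
      (A.card : ℝ)⁻¹ * ∑ a ∈ A, ‖amplitude A v ((y + l) / N)‖ ^ 2 *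
        ‖mask (B a) ((y + l) / N)‖ ^ 2 := by
    intro l _
    rw [mul_left_comm, mul_sum]
  rw [sum_congr rfl h4, ← mul_sum, sum_comm, sum_congr rfl key, sum_const, nsmul_eq_mul,
    inv_mul_cancel_left₀ hA']

/-- The mask of a product-form digit set. -/
theorem mask_productFormDigits {N r : ℕ} (hr : r ≠ 0) (hN : N ≠ 0) {A L₁ L₂ : Finset ℤ}
    {B : ℤ → Finset ℤ} (hA : IsHadamardTriple N A L₁)
    (hB : ∀ a ∈ A, IsHadamardTriple N (B a) L₂) (t : ℝ) :
    mask (productFormDigits N r A B) t =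
      amplitude A (fun a => mask (B a) ((N : ℝ) ^ r * t)) t := by
  have hNr : ((N : ℤ) ^ r) ≠ 0 := pow_ne_zero _ (by exact_mod_cast hN)
  have hinj : ∀ a, Set.InjOn (fun b : ℤ => a + (N : ℤ) ^ r * b) (B a) := by
    intro a b _ b' _ hbb
    exact mul_left_cancel₀ hNr (add_left_cancel hbb)
  -- For `r ≥ 1` the pieces lie in distinct residue classes modulo `N`, because the elements of `A`
  -- do.
  have hdisj : (A : Set ℤ).PairwiseDisjoint fun a =>
      (B a).image fun b => a + (N : ℤ) ^ r * b := by
    intro a ha a' ha' hne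
    rw [Function.onFun, disjoint_left]
    intro x hx hx'
    obtain ⟨b, _, rfl⟩ := mem_image.1 hx
    obtain ⟨b', _, hb'⟩ := mem_image.1 hx'
    refine hne (hA.eq_of_dvd_sub ha ha' ?_)
    have : a - a' = (N : ℤ) ^ r * (b' - b) := by linarith
    rw [this]
    exact (dvd_pow_self _ hr).mul_right _
  have hcard : (productFormDigits N r A B).card = A.card * L₂.card := by
    rw [productFormDigits, card_biUnion hdisj, ← smul_eq_mul, ← sum_const]
    exact sum_congr rfl fun a ha => by rw [card_image_of_injOn (hinj a), (hB a ha).card_eq]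
  rw [mask_eq, hcard, productFormDigits, sum_biUnion hdisj, amplitude, Nat.cast_mul, mul_inv,
    mul_assoc, mul_sum]
  congr 1
  refine sum_congr rfl fun a ha => ?_
  rw [sum_image (hinj a), mask_eq, (hB a ha).card_eq, mul_assoc, sum_mul]
  congr 1
  refine sum_congr rfl fun b _ => ?_
  rw [← unitExp_add]
  congr 1
  push_cast
  ring

/-! ### Digits of several scales -/

/-- For `1`-periodic functions `G i` whose sums over the `N`-adic preimages with digits in `L` are
constant, the sums of products over `r` scales factorize. -/
theorem exists_multiscale_digits {N : ℕ} (hN : N ≠ 0) (L : Finset ℤ) (r : ℕ) :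
    ∃ (κ : Type) (_ : Fintype κ) (l : κ → ℤ), ∀ (G : ℕ → ℝ → ℝ) (c : ℕ → ℝ),
      (∀ i, ∀ t, ∀ n : ℤ, G i (t + n) = G i t) →
      (∀ i, ∀ y, ∑ k ∈ L, G i ((y + k) / N) = c i) → ∀ y,
        ∑ k, ∏ i ∈ range r, G i ((N : ℝ) ^ i * ((y + l k) / (N : ℝ) ^ r)) =
          ∏ i ∈ range r, c i := by
  have hN' : (N : ℝ) ≠ 0 := by exact_mod_cast hN
  induction r with
  | zero => exact ⟨Unit, inferInstance, fun _ => 0, fun G c _ _ y => by simp⟩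
  | succ r ih =>
    obtain ⟨κ, hκ, l, hl⟩ := ih
    -- The new top digit `N ^ r * x` contributes an integer to every factor with `i ≥ 1`, so it is
    -- felt by `G 0` alone and can be summed first.
    refine ⟨κ × L, inferInstance, fun x => l x.1 + (N : ℤ) ^ r * (x.2 : ℤ),
      fun G c hG hc y => ?_⟩
    have hpow := pow_ne_zero r hN'
    have h1 : ∀ (k : κ) (x : L), ∏ i ∈ range (r + 1),
        G i ((N : ℝ) ^ i * ((y + ((l k + (N : ℤ) ^ r * (x : ℤ) : ℤ) : ℝ)) / (N : ℝ) ^ (r + 1))) =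
        (∏ i ∈ range r, G (i + 1) ((N : ℝ) ^ i * ((y + l k) / (N : ℝ) ^ r))) *
          G 0 (((y + l k) / (N : ℝ) ^ r + (x : ℤ)) / N) := by
      intro k x
      rw [prod_range_succ']
      congr 1
      · refine prod_congr rfl fun i _ => ?_
        have : (N : ℝ) ^ (i + 1) *
            ((y + ((l k + (N : ℤ) ^ r * (x : ℤ) : ℤ) : ℝ)) / (N : ℝ) ^ (r + 1)) =
            (N : ℝ) ^ i * ((y + l k) / (N : ℝ) ^ r) + (((N : ℤ) ^ i * (x : ℤ) : ℤ) : ℝ) := by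
          push_cast
          rw [pow_succ, pow_succ]
          field_simp
          ring
        rw [this, hG]
      · congr 1
        push_cast
        rw [pow_succ]
        field_simp
        ring
    rw [Fintype.sum_prod_type]
    simp_rw [h1, ← mul_sum]
    have h2 : ∀ k, ∑ x : L, G 0 (((y + l k) / (N : ℝ) ^ r + (x : ℤ)) / N) = c 0 := by
      intro k
      rw [← hc 0 ((y + l k) / (N : ℝ) ^ r)]
      exact Finset.sum_coe_sort L fun x : ℤ => G 0 (((y + l k) / (N : ℝ) ^ r + x) / N)
    simp_rw [h2]
    rw [← sum_mul, hl (fun i => G (i + 1)) (fun i => c (i + 1)) (fun i => hG (i + 1))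
      (fun i => hc (i + 1)), ← prod_range_succ']

/-! ### The squared modulus of the Fourier transform -/

/-- The modulus of continuity `ψ (s - t) = ∫ |e^{i(s-t)x} - 1| dμ` depends only on the difference
and tends to `0` by dominated convergence. -/
theorem uniformContinuous_charFun (μ : Measure ℝ) [IsProbabilityMeasure μ] :
    UniformContinuous (charFun μ) := by
  set ψ : ℝ → ℝ := fun s => ∫ x : ℝ, ‖Complex.exp (s * x * Complex.I) - 1‖ ∂μ with hψ
  have hexp : ∀ s x : ℝ, ‖Complex.exp (s * x * Complex.I)‖ = 1 := fun s x => by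
    rw [← Complex.ofReal_mul, Complex.norm_exp_ofReal_mul_I]
  have hint : ∀ s : ℝ, Integrable (fun x : ℝ => Complex.exp (s * x * Complex.I)) μ := fun s =>
    Integrable.of_bound (by fun_prop) 1 (Eventually.of_forall fun x => (hexp s x).le)
  have hcont : Continuous ψ := by
    refine continuous_of_dominated (bound := fun _ => 2) (fun s => by fun_prop)
      (fun s => Eventually.of_forall fun x => ?_) (integrable_const _)
      (Eventually.of_forall fun x => by fun_prop)
    rw [norm_norm]
    refine (norm_sub_le _ _).trans ?_
    rw [hexp, norm_one]
    norm_num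
  have hle : ∀ s t, ‖charFun μ s - charFun μ t‖ ≤ ψ (s - t) := by
    intro s t
    rw [charFun_apply_real, charFun_apply_real, ← integral_sub (hint s) (hint t)]
    refine (norm_integral_le_integral_norm _).trans_eq ?_
    refine integral_congr_ae (Eventually.of_forall fun x => ?_)
    have : Complex.exp (s * x * Complex.I) - Complex.exp (t * x * Complex.I) =
        Complex.exp (t * x * Complex.I) *
          (Complex.exp (((s - t : ℝ) : ℂ) * x * Complex.I) - 1) := by
      rw [mul_sub, mul_one, ← Complex.exp_add]
      congr 2
      push_cast
      ring
    simp only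
    rw [this, norm_mul, hexp, one_mul]
  rw [Metric.uniformContinuous_iff]
  intro ε hε
  have h0 : ψ 0 = 0 := by simp [hψ]
  obtain ⟨δ, hδ, h⟩ := Metric.continuous_iff.1 hcont 0 ε hε
  refine ⟨δ, hδ, fun {s t} hst => ?_⟩
  rw [dist_eq_norm]
  refine (hle s t).trans_lt ?_
  have h1 := h (s - t) (by rwa [dist_zero_right, ← dist_eq_norm])
  rw [h0, Real.dist_eq, sub_zero] at h1
  exact (le_abs_self _).trans_lt h1

/-- The function `t ↦ |∫ e^{2πitx} dμ(x)|²`. -/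
def sqTransform (μ : Measure ℝ) (t : ℝ) : ℝ := ‖charFun μ (2 * Real.pi * t)‖ ^ 2

theorem sqTransform_le_one (μ : Measure ℝ) [IsProbabilityMeasure μ] (t : ℝ) :
    sqTransform μ t ≤ 1 :=
  pow_le_one₀ (norm_nonneg _) (norm_charFun_le_one _)

theorem sqTransform_zero (μ : Measure ℝ) [IsProbabilityMeasure μ] : sqTransform μ 0 = 1 := by
  simp [sqTransform, charFun_zero]

theorem uniformContinuous_sqTransform (μ : Measure ℝ) [IsProbabilityMeasure μ] :
    UniformContinuous (sqTransform μ) := by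
  have h1 : UniformContinuous fun t : ℝ => ‖charFun μ (2 * Real.pi * t)‖ := by
    refine uniformContinuous_norm.comp ((uniformContinuous_charFun μ).comp ?_)
    exact uniformContinuous_id.const_mul' (2 * Real.pi)
  rw [Metric.uniformContinuous_iff] at h1 ⊢
  intro ε hε
  obtain ⟨δ, hδ, h⟩ := h1 (ε / 2) (half_pos hε)
  refine ⟨δ, hδ, fun {s t} hst => ?_⟩
  have h2 := h hst
  have hs : ‖charFun μ (2 * Real.pi * s)‖ ≤ 1 := norm_charFun_le_one _
  have ht : ‖charFun μ (2 * Real.pi * t)‖ ≤ 1 := norm_charFun_le_one _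
  rw [Real.dist_eq] at h2 ⊢
  rw [sqTransform, sqTransform, sq_sub_sq, abs_mul]
  have h3 : |‖charFun μ (2 * Real.pi * s)‖ + ‖charFun μ (2 * Real.pi * t)‖| ≤ 2 := by
    rw [abs_of_nonneg (by positivity)]
    linarith
  nlinarith [abs_nonneg (‖charFun μ (2 * Real.pi * s)‖ - ‖charFun μ (2 * Real.pi * t)‖)]

theorem IsSelfSimilarMeasure.sqTransform_mul {N : ℕ} {D : Finset ℤ} {μ : Measure ℝ}
    (h : IsSelfSimilarMeasure N D μ) (hN : N ≠ 0) (t : ℝ) :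
    sqTransform μ (N * t) = ‖mask D t‖ ^ 2 * sqTransform μ t := by
  have hN' : (N : ℝ) ≠ 0 := by exact_mod_cast hN
  have hN'' : (N : ℂ) ≠ 0 := by exact_mod_cast hN
  rw [sqTransform, h.charFun_eq, norm_mul, mul_pow, ← mul_sum, mask_eq]
  congr 1
  · congr 3
    refine sum_congr rfl fun d _ => ?_
    rw [unitExp]
    congr 1
    push_cast
    field_simp
  · rw [sqTransform]
    congr 3
    field_simp

theorem IsSelfSimilarMeasure.sqTransform_pow_mul {N : ℕ} {D : Finset ℤ} {μ : Measure ℝ}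
    (h : IsSelfSimilarMeasure N D μ) (hN : N ≠ 0) (r : ℕ) (t : ℝ) :
    sqTransform μ ((N : ℝ) ^ r * t) =
      (∏ i ∈ range r, ‖mask D ((N : ℝ) ^ i * t)‖ ^ 2) * sqTransform μ t := by
  induction r with
  | zero => simp
  | succ r ih =>
    rw [pow_succ', mul_assoc, h.sqTransform_mul hN, ih, prod_range_succ]
    ring

theorem analyticOnNhd_mask_mul (D : Finset ℤ) (c : ℝ) :
    AnalyticOnNhd ℝ (fun t => mask D (c * t)) Set.univ := by
  have h : (fun t => mask D (c * t)) =
      fun t => (D.card : ℂ)⁻¹ * ∑ d ∈ D, unitExp ((d * c) * t) := by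
    funext t
    rw [mask_eq]
    simp only [mul_assoc]
  rw [h]
  exact analyticOnNhd_const.mul
    (Finset.analyticOnNhd_fun_sum D fun d _ => analyticOnNhd_unitExp_mul (d * c))

/-- Infinitely many zeros in `[0, 1]` would accumulate, forcing `f = 0` by the identity theorem. -/
theorem finite_zeros_of_analyticOnNhd {f : ℝ → ℂ} (hf : AnalyticOnNhd ℝ f Set.univ)
    (h0 : f 0 ≠ 0) : {t | t ∈ Set.Icc (0 : ℝ) 1 ∧ f t = 0}.Finite := by
  by_contra hinf
  obtain ⟨x, _, hx⟩ := Set.Infinite.exists_accPt_of_subset_isCompact hinf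
    (isCompact_Icc (a := (0 : ℝ)) (b := 1)) fun t ht => ht.1
  have hfreq : ∃ᶠ t in 𝓝[≠] x, f t = 0 :=
    (accPt_iff_frequently_nhdsNE.1 hx).mono fun t ht => ht.2
  exact h0 (hf.eqOn_zero_of_preconnected_of_frequently_eq_zero isPreconnected_univ
    (Set.mem_univ x) hfreq (Set.mem_univ 0))

/-- After `k` scalings `[0, 1]` lies where the transform is close to `1`, so all zeros come from `k`
analytic masks. -/
theorem IsSelfSimilarMeasure.finite_zeros {N : ℕ} {D : Finset ℤ} {μ : Measure ℝ}
    (h : IsSelfSimilarMeasure N D μ) (hN : 2 ≤ N) (hD : D.Nonempty) :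
    {t | t ∈ Set.Icc (0 : ℝ) 1 ∧ sqTransform μ t = 0}.Finite := by
  have := h.isProbabilityMeasure
  have hN0 : N ≠ 0 := by omega
  have hN' : (N : ℝ) ≠ 0 := by exact_mod_cast hN0
  have hN1 : (1 : ℝ) < N := by exact_mod_cast (by omega : 1 < N)
  obtain ⟨δ, hδ, hδ'⟩ : ∃ δ > 0, ∀ t : ℝ, |t| < δ → sqTransform μ t ≠ 0 := by
    obtain ⟨δ, hδ, hd⟩ := Metric.continuous_iff.1 (uniformContinuous_sqTransform μ).continuous 0 1
      one_pos
    refine ⟨δ, hδ, fun t ht h0 => ?_⟩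
    have := hd t (by rwa [Real.dist_eq, sub_zero])
    rw [h0, sqTransform_zero] at this
    simp at this
  obtain ⟨k, hk⟩ : ∃ k : ℕ, 1 / (N : ℝ) ^ k < δ :=
    (((tendsto_pow_atTop_atTop_of_one_lt hN1).const_div_atTop 1).eventually_lt_const hδ).exists
  have hfin : (⋃ j ∈ range k, {t : ℝ | t ∈ Set.Icc (0 : ℝ) 1 ∧
      mask D ((N : ℝ)⁻¹ ^ (j + 1) * t) = 0}).Finite := by
    refine (range k).finite_toSet.biUnion fun j _ => ?_
    refine finite_zeros_of_analyticOnNhd (analyticOnNhd_mask_mul D _) ?_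
    rw [mul_zero, mask_zero hD]
    exact one_ne_zero
  have key : ∀ (n : ℕ) (t : ℝ), sqTransform μ t = 0 →
      (∃ j ∈ range n, mask D ((N : ℝ)⁻¹ ^ (j + 1) * t) = 0) ∨
        sqTransform μ ((N : ℝ)⁻¹ ^ n * t) = 0 := by
    intro n t ht
    induction n with
    | zero => right; simpa using ht
    | succ n ih =>
      rcases ih with ⟨j, hj, hz⟩ | hz
      · exact Or.inl ⟨j, mem_range.2 ((mem_range.1 hj).trans (Nat.lt_succ_self n)), hz⟩
      · have : (N : ℝ)⁻¹ ^ n * t = N * ((N : ℝ)⁻¹ ^ (n + 1) * t) := by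
          rw [pow_succ]
          field_simp
        rw [this, h.sqTransform_mul hN0, mul_eq_zero] at hz
        rcases hz with hz | hz
        · exact Or.inl ⟨n, mem_range.2 (Nat.lt_succ_self n),
            norm_eq_zero.1 (pow_eq_zero_iff two_ne_zero |>.1 hz)⟩
        · exact Or.inr hz
  refine hfin.subset fun t ht => ?_
  rcases key k t ht.2 with ⟨j, hj, hz⟩ | hz
  · exact Set.mem_biUnion hj ⟨ht.1, hz⟩
  · refine absurd hz (hδ' _ ?_)
    rw [abs_of_nonneg (mul_nonneg (by positivity) ht.1.1), inv_pow]
    have hpos : (0 : ℝ) < ((N : ℝ) ^ k)⁻¹ := by positivity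
    rw [one_div] at hk
    exact (mul_le_of_le_one_right hpos.le ht.1.2).trans_lt hk

theorem uniformContinuous_of_add_int {f : ℝ → ℝ} (hf : Continuous f)
    (hper : ∀ t, ∀ n : ℤ, f (t + n) = f t) : UniformContinuous f := by
  have hp : Function.Periodic f 1 := fun t => by simpa using hper t 1
  have : Fact ((0 : ℝ) < 1) := ⟨one_pos⟩
  have h1 : Continuous (hp.lift : AddCircle (1 : ℝ) → ℝ) := continuous_coinduced_dom.2 hf
  have h2 : UniformContinuous (QuotientAddGroup.mk' (AddSubgroup.zmultiples (1 : ℝ))) :=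
    uniformContinuous_of_continuousAt_zero _ (continuous_quot_mk.continuousAt)
  exact (CompactSpace.uniformContinuous_of_continuous h1).comp h2

/-! ### Spectral measures from harmonic systems -/

/-- The translates of the frequency set of `w` by the `m k` exhaust `∑ w (ξ + m k) = 1`. -/
theorem isSpectralMeasure_of_isHarmonicSystem {μ : Measure ℝ} [IsProbabilityMeasure μ]
    {κ : Type} [Fintype κ] {M C : ℝ} {l : κ → ℝ} {Γ : AddSubgroup ℝ} {p w : ℝ → ℝ}
    (h : IsHarmonicSystem M C l Γ p w (sqTransform μ))
    (hfin : {t | t ∈ Set.Icc (0 : ℝ) 1 ∧ sqTransform μ t = 0}.Finite)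
    (hrig : ∀ η, p η = 1 → p (M * η) = 1 → M * η ∈ Γ)
    {κ' : Type} [Fintype κ'] {m : κ' → ℝ} (hm : ∀ y, ∑ k, w (y + m k) = 1) :
    IsSpectralMeasure μ := by
  classical
  obtain ⟨Λ', hΛ', hsum'⟩ := h.exists_hasSum (h.exists_translate_ne_zero hfin hrig)
  have : Countable Λ' := hΛ'
  set f : κ' × Λ' → ℝ := fun x => m x.1 + x.2 with hf
  have hsum : ∀ ξ : ℝ, HasSum (fun x => sqTransform μ (ξ + f x)) 1 := by
    intro ξ
    have hfib : ∀ k : κ', HasSum (fun x : Λ' => sqTransform μ (ξ + f (k, x))) (w (ξ + m k)) := by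
      intro k
      simpa only [hf, add_assoc] using hsum' (ξ + m k)
    have hs : Summable fun x => sqTransform μ (ξ + f x) := by
      rw [summable_prod_of_nonneg fun x => h.φ_nonneg _]
      exact ⟨fun k => (hfib k).summable, Summable.of_finite⟩
    have h1 := (hs.hasSum.prod_fiberwise hfib).unique (hasSum_fintype _)
    rw [hm] at h1
    exact h1 ▸ hs.hasSum
  -- A repeated frequency would give two terms `φ 0 = 1` in a sum equal to `1`, so the translates
  -- are disjoint.
  have hinj : Function.Injective f := by
    intro x y hxy
    by_contra hne
    have h1 := sum_le_hasSum {x, y} (fun _ _ => h.φ_nonneg _) (hsum (-f x))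
    rw [sum_pair hne, ← hxy, neg_add_cancel, h.φ_zero] at h1
    norm_num at h1
  refine isSpectralMeasure_of_hasSum (Set.countable_range f) fun ξ => ?_
  exact (hinj.hasSum_range_iff (f := fun a : ℝ => sqTransform μ (ξ + a))).2 (hsum ξ)

theorem natCast_mul_mem (Γ : AddSubgroup ℝ) (n : ℕ) {γ : ℝ} (hγ : γ ∈ Γ) : (n : ℝ) * γ ∈ Γ := by
  rw [← nsmul_eq_mul]
  exact Γ.nsmul_mem hγ n

/-- The self-similar measure of a Hadamard triple is spectral. -/
theorem IsHadamardTriple.isSpectralMeasure {N : ℕ} {D L : Finset ℤ} (h : IsHadamardTriple N D L)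
    (hN : 2 ≤ N) : IsSpectralMeasure (selfSimilarMeasure N D) := by
  have hself := isSelfSimilarMeasure_selfSimilarMeasure hN h.nonempty
  have := hself.isProbabilityMeasure
  set μ := selfSimilarMeasure N D
  have hsum : ∀ y : ℝ, ∑ k : L, ‖mask D ((y + (k : ℤ)) / N)‖ ^ 2 = 1 := fun y => by
    rw [← h.sum_norm_sq_mask y]
    exact Finset.sum_coe_sort L fun l : ℤ => ‖mask D ((y + l) / N)‖ ^ 2
  have hsys : IsHarmonicSystem (N : ℝ) 1 (fun k : L => ((k : ℤ) : ℝ)) (differenceDual D)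
      (fun t => ‖mask D t‖ ^ 2) (fun _ => 1) (sqTransform μ) :=
    { one_lt := by exact_mod_cast (by omega : 1 < N)
      digit_mem := fun k => int_mem_differenceDual D k
      one_mem := by simpa using int_mem_differenceDual D 1
      mul_mem := fun γ hγ => natCast_mul_mem _ N hγ
      p_nonneg := fun t => by positivity
      p_le_one := fun t => pow_le_one₀ (norm_nonneg _) (norm_mask_le_one _ _)
      p_add := fun t γ hγ => by rw [norm_mask_add t hγ]
      w_nonneg := fun _ => zero_le_one
      w_le_one := fun _ => le_rfl
      w_zero := rfl
      w_add := fun _ _ _ => rfl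
      w_cont := uniformContinuous_const
      φ_nonneg := fun t => by unfold sqTransform; positivity
      φ_le_one := sqTransform_le_one μ
      φ_zero := sqTransform_zero μ
      φ_cont := uniformContinuous_sqTransform μ
      φ_mul := fun t => hself.sqTransform_mul (by omega) t
      harmonic := fun y => by simp only [mul_one]; exact hsum y
      bound := fun y => by rw [mul_one]; exact (hsum y).le }
  refine isSpectralMeasure_of_isHarmonicSystem hsys (hself.finite_zeros hN h.nonempty)
    (fun η hη _ => ?_) (κ' := Unit) (m := fun _ => 0) fun y => by simp
  exact natCast_mul_mem _ N (mem_differenceDual_of_norm_mask_eq_one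
    ((pow_eq_one_iff_of_nonneg (norm_nonneg _) two_ne_zero).1 hη))

/-- The self-similar measure of a product-form digit set with `r ≥ 1` is spectral. -/
theorem isSpectralMeasure_productFormDigits {N r : ℕ} (hN : 2 ≤ N) (hr : r ≠ 0)
    {A L₁ L₂ : Finset ℤ} {B : ℤ → Finset ℤ} (hL : IsDirectSum L₁ L₂)
    (hA : IsHadamardTriple N A L₁) (hB : ∀ a ∈ A, IsHadamardTriple N (B a) L₂)
    (hAB : ∀ a ∈ A, IsDirectSum A (B a) ∧ IsHadamardTriple N (A + B a) (L₁ + L₂)) :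
    IsSpectralMeasure (selfSimilarMeasure N (productFormDigits N r A B)) := by
  have hN0 : N ≠ 0 := by omega
  have hN' : (N : ℝ) ≠ 0 := by exact_mod_cast hN0
  have hNr : (N : ℝ) ^ r ≠ 0 := pow_ne_zero r hN'
  set D := productFormDigits N r A B with hDdef
  have hmemD : ∀ a ∈ A, ∀ b ∈ B a, a + (N : ℤ) ^ r * b ∈ D := fun a ha b hb =>
    mem_biUnion.2 ⟨a, ha, mem_image_of_mem _ hb⟩
  have hD : D.Nonempty := by
    obtain ⟨a, ha⟩ := hA.nonempty
    obtain ⟨b, hb⟩ := (hB a ha).nonempty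
    exact ⟨_, hmemD a ha b hb⟩
  have hself := isSelfSimilarMeasure_selfSimilarMeasure hN hD
  have := hself.isProbabilityMeasure
  set μ := selfSimilarMeasure N D
  -- Membership in `differenceDual D` makes `p` invariant, and in all `differenceDual (B a)` makes
  -- `w` invariant.
  set Γ : AddSubgroup ℝ := differenceDual D ⊓ ⨅ a ∈ A, differenceDual (B a) with hΓ
  have hΓD : ∀ γ ∈ Γ, γ ∈ differenceDual D := fun γ hγ => hγ.1
  have hΓB : ∀ γ ∈ Γ, ∀ a ∈ A, γ ∈ differenceDual (B a) := fun γ hγ a ha => by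
    have := (AddSubgroup.mem_inf.1 hγ).2
    simp only [AddSubgroup.mem_iInf] at this
    exact this a ha
  have hmem : ∀ γ : ℝ, γ ∈ differenceDual D → (∀ a ∈ A, γ ∈ differenceDual (B a)) → γ ∈ Γ :=
    fun γ h1 h2 => by
      refine AddSubgroup.mem_inf.2 ⟨h1, ?_⟩
      simp only [AddSubgroup.mem_iInf]
      exact h2
  have hint : ∀ n : ℤ, (n : ℝ) ∈ Γ := fun n =>
    hmem _ (int_mem_differenceDual D n) fun a _ => int_mem_differenceDual (B a) n
  have hpowmem : ∀ (i : ℕ), ∀ γ ∈ Γ, (N : ℝ) ^ i * γ ∈ Γ := fun i γ hγ => by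
    simpa using natCast_mul_mem Γ (N ^ i) hγ
  set p : ℝ → ℝ := fun t => ∏ i ∈ range r, ‖mask D ((N : ℝ) ^ i * t)‖ ^ 2 with hp
  set w : ℝ → ℝ := fun t => ∏ i ∈ range r, meanMask A B ((N : ℝ) ^ i * t) with hw
  have hpn : ∀ t, 0 ≤ p t := fun t => prod_nonneg fun i _ => by positivity
  have hmask1 : ∀ t, ‖mask D t‖ ^ 2 ≤ 1 := fun t =>
    pow_le_one₀ (norm_nonneg _) (norm_mask_le_one _ _)
  have hmeanadd : ∀ t, ∀ γ ∈ Γ, meanMask A B (t + γ) = meanMask A B t := fun t γ hγ => by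
    unfold meanMask
    congr 1
    exact sum_congr rfl fun a ha => by rw [norm_mask_add t (hΓB γ hγ a ha)]
  have hwadd : ∀ t, ∀ γ ∈ Γ, w (t + γ) = w t := fun t γ hγ =>
    prod_congr rfl fun i _ => by rw [mul_add, hmeanadd _ _ (hpowmem i γ hγ)]
  have hwc : Continuous w := continuous_finsetProd _ fun i _ =>
    (continuous_meanMask A B).comp (continuous_const.mul continuous_id)
  obtain ⟨κ, hκ, l, hl⟩ := exists_multiscale_digits hN0 (L₁ + L₂) r
  obtain ⟨κ', hκ', m, hm⟩ := exists_multiscale_digits hN0 L₂ r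
  -- The coefficients of the masks of `D` on the preimages of `y`: periodicity removes the digit `l
  -- k`, so one Parseval identity serves all preimages.
  set v : ℝ → ℕ → ℤ → ℂ := fun y i a => mask (B a) ((N : ℝ) ^ i * y) with hv
  have hpv : ∀ (y : ℝ) (k : κ), p ((y + l k) / (N : ℝ) ^ r) =
      ∏ i ∈ range r, ‖amplitude A (v y i) ((N : ℝ) ^ i * ((y + l k) / (N : ℝ) ^ r))‖ ^ 2 := by
    intro y k
    refine prod_congr rfl fun i _ => ?_
    rw [hDdef, mask_productFormDigits hr hN0 hA hB]
    congr 4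
    funext a
    have : (N : ℝ) ^ r * ((N : ℝ) ^ i * ((y + l k) / (N : ℝ) ^ r)) =
        (N : ℝ) ^ i * y + (((N : ℤ) ^ i * l k : ℤ) : ℝ) := by
      push_cast
      field_simp
    rw [this, mask_add_int]
  have hmeanv : ∀ y i, (A.card : ℝ)⁻¹ * ∑ a ∈ A, ‖v y i a‖ ^ 2 =
      meanMask A B ((N : ℝ) ^ i * y) := fun y i => rfl
  have hharm : ∀ y, ∑ k, p ((y + l k) / (N : ℝ) ^ r) * w ((y + l k) / (N : ℝ) ^ r) = w y := by
    intro y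
    refine Eq.trans ?_ (hl (fun i t => ‖amplitude A (v y i) t‖ ^ 2 * meanMask A B t)
      (fun i => meanMask A B ((N : ℝ) ^ i * y)) ?_ ?_ y)
    · refine sum_congr rfl fun k _ => ?_
      rw [hpv, ← prod_mul_distrib]
    · intro i t n
      rw [amplitude_add_int, hmeanadd t n (hint n)]
    · intro i z
      rw [sum_norm_sq_amplitude_mul_meanMask hA.nonempty hAB, hmeanv]
  have hbound : ∀ y, ∑ k, p ((y + l k) / (N : ℝ) ^ r) = (L₂.card : ℝ) ^ r * w y := by
    intro y
    have h1 := hl (fun i t => ‖amplitude A (v y i) t‖ ^ 2)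
      (fun i => L₂.card * meanMask A B ((N : ℝ) ^ i * y)) (fun i t n => by
        rw [amplitude_add_int]) (fun i z => by
        rw [sum_norm_sq_amplitude_add hL hA, hmeanv]) y
    simp_rw [hpv]
    rw [h1, prod_mul_distrib, prod_const, card_range]
  have hsys : IsHarmonicSystem ((N : ℝ) ^ r) ((L₂.card : ℝ) ^ r) (fun k => (l k : ℝ)) Γ p w
      (sqTransform μ) :=
    { one_lt := one_lt_pow₀ (by exact_mod_cast (by omega : 1 < N)) hr
      digit_mem := fun k => hint (l k)
      one_mem := by simpa using hint 1
      mul_mem := hpowmem r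
      p_nonneg := hpn
      p_le_one := fun t => prod_le_one (fun i _ => by positivity) fun i _ => hmask1 _
      p_add := fun t γ hγ => prod_congr rfl fun i _ => by
        rw [mul_add, norm_mask_add _ (hΓD _ (hpowmem i γ hγ))]
      w_nonneg := fun t => prod_nonneg fun i _ => meanMask_nonneg A B _
      w_le_one := fun t => prod_le_one (fun i _ => meanMask_nonneg A B _)
        fun i _ => meanMask_le_one A B _
      w_zero := prod_eq_one fun i _ => by
        rw [mul_zero, meanMask_zero hA.nonempty fun a ha => (hB a ha).nonempty]
      w_add := hwadd
      w_cont := uniformContinuous_of_add_int hwc fun t n => hwadd t n (hint n)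
      φ_nonneg := fun t => by unfold sqTransform; positivity
      φ_le_one := sqTransform_le_one μ
      φ_zero := sqTransform_zero μ
      φ_cont := uniformContinuous_sqTransform μ
      φ_mul := hself.sqTransform_pow_mul hN0 r
      harmonic := hharm
      bound := fun y => (hbound y).le }
  have hpD : ∀ t, p t = 1 → t ∈ differenceDual D := by
    intro t ht
    have h0 : (0 : ℕ) ∈ range r := mem_range.2 (Nat.pos_of_ne_zero hr)
    have h1 : p t ≤ ‖mask D t‖ ^ 2 := by
      rw [hp]
      simp only
      rw [← mul_prod_erase _ _ h0, pow_zero, one_mul]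
      exact mul_le_of_le_one_right (by positivity)
        (prod_le_one (fun i _ => by positivity) fun i _ => hmask1 _)
    refine mem_differenceDual_of_norm_mask_eq_one ?_
    exact (pow_eq_one_iff_of_nonneg (norm_nonneg _) two_ne_zero).1
      (le_antisymm (hmask1 t) (ht ▸ h1))
  refine isSpectralMeasure_of_isHarmonicSystem hsys (hself.finite_zeros hN hD) (fun η h1 h2 => ?_)
    (κ' := κ') (m := fun k => (m k : ℝ) / (N : ℝ) ^ r) fun y => ?_
  -- Two digits of `D` with the same `a` differ by `N ^ r * (b - b')`, so `η ∈ differenceDual D`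
  -- yields `N ^ r * η ∈ differenceDual (B a)`.
  · refine hmem _ (hpD _ h2) fun a ha b hb b' hb' => ?_
    obtain ⟨n, hn⟩ := hpD η h1 _ (hmemD a ha b hb) _ (hmemD a ha b' hb')
    refine ⟨n, ?_⟩
    rw [← hn]
    push_cast
    ring
  -- Here all scales use the digits `L₂` and the same function, so dividing the digits by `N ^ r`
  -- gives translates of `w` with sum `1`.
  · have h1 := hm (fun _ => meanMask A B) (fun _ => 1) (fun _ t n => hmeanadd t n (hint n))
      (fun _ z => sum_meanMask hA.nonempty hB z) ((N : ℝ) ^ r * y)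
    rw [prod_const_one] at h1
    rw [← h1]
    refine sum_congr rfl fun k _ => ?_
    rw [add_div, mul_div_cancel_left₀ _ hNr]

end

theorem theorem2p1 (N : ℕ) (D L₁ L₂ : Finset ℤ)
    (h : IsProductFormHadamardTriple N D L₁ L₂) :
    IsSpectralMeasure (selfSimilarMeasure N D) := by
  obtain ⟨hN, hL, A, B, r, rfl, hA, hB, hAB, hr⟩ := h
  rcases eq_or_ne r 0 with h0 | h0
  · exact (hr h0).isSpectralMeasure hN
  · exact isSpectralMeasure_productFormDigits hN h0 hL hA hB hAB
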